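/- **Setting.** Let $N_0,N_1,A,H$ be positive integers with $H\ge 50$, $H\ge \frac54\log(10N_0)$, $A\ge 10H$, $N_1\ge 500$, $N_1\ge 160N_0$, put $\beta=\frac{8}{H-8}$, and let $C\ge 1$. Consider the following MDP $\mathcal M$ with episode length $H$, $A$ actions and state space $\mathbf E\cup\mathbf E'\cup\{\mathbf b,\mathbf b'\}$ (disjoint), $|\mathbf E|=N_0$, $|\mathbf E'|=N_1$, and an arbitrary deterministic expert policy $\pi^{\mathrm E}$, which assigns an action to each state. - Initial state: with probability $\frac1{1+\beta}$ uniform on $\mathbf E$, with probability $\frac{\beta}{1+\beta}$ uniform on $\mathbf E'$. - From $s\in\mathbf E$: the action $\pi^{\mathrm E}(s)$ leads with probability $1-\beta$ to a uniform state of $\mathbf E$ and with probability $\beta$ to a uniform state of $\mathbf E'$; every other action leads to $\mathbf b$. - From $s\in\mathbf E'$: the action $\pi^{\mathrm E}(s)$ leads to a uniform state of $\mathbf E$; every other action leads to $\mathbf b'$. - $\mathbf b$ is absorbing. From $\mathbf b'$: the action $\pi^{\mathrm E}(\mathbf b')$ leads to a uniform state of $\mathbf E$; every other action stays in $\mathbf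 b'$. - Reward: $1$ in every state of $\mathbf E\cup\mathbf E'$ (for any action), $1$ in $\mathbf b'$ under the action $\pi^{\mathrm E}(\mathbf b')$, and $0$ otherwise. $J(\pi)$ is the expected total reward of $\pi$ over the $H$ steps, and the suboptimality of $\pi$ is $J(\pi^{\mathrm E})-J(\pi)$. **Learners.** From the set of (state, expert action) pairs annotated so far, the learner forms the policy that plays the expert's action at every annotated state and a uniformly random action at every other state. *BC* outputs this policy for the annotations in $N_{\mathrm{off}}$ i.i.d. expert trajectories. *Stagger* starts without annotations and performs $N_{\mathrm{int}}$ rounds; in round $n$ it executes its current policy $\pi^n$, picks the state at a uniformly random step of the rollout, and queries the expert's action there. *Warm-Stagger* performs $N_{\mathrm{int}}$ such rounds starting from the annotations in $N_{\mathrm{off}}$ i.i.d. expert trajectories. Both output the policy formed from all annotations collected. The cost of $N_{\mathrm{off}}$ trajectories and $N_{\mathrm{int}}$ queries is $H N_{\mathrm{off}}+C N_{\mathrm{int}}$. **Theorem.** 1. If BC outputs, with probability at least $\frac12$, a policy of suboptimality smaller than $\frac H2$, then $N_{\mathrm{off}}\ge \frac{N_1}{160}$, so that its cost is at least $\frac{HN_1}{160}$.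 2. If Stagger outputs, with probability at least $\frac12$, a policy of suboptimality smaller than $\frac H2$, then $N_{\mathrm{int}}>\frac{HN_0}{12}$, so that its cost exceeds $\frac{CHN_0}{12}$. The same holds if Stagger outputs instead the first-step uniform mixture of $\pi^1,\dots,\pi^{N_{\mathrm{int}}}$ (one of them is drawn uniformly and executed for the whole episode). 3. Warm-Stagger with $$N_{\mathrm{off}}=\left\lceil \frac{N_0}{(1-\beta)H}\log(10N_0)\right\rceil\le 6\,\frac{N_0}{H}\log N_0+1$$ offline trajectories and $N_{\mathrm{int}}=3$ interactive queries, hence at cost at most $6N_0\log N_0+H+3C$, outputs with probability at least $\frac12$ a policy $\hat\pi$ with $J(\hat\pi)=J(\pi^{\mathrm E})$. -/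

import Mathlib

open scoped ENNReal NNReal

namespace HybridIL

noncomputable section

/-! ### Finite-horizon Markov decision processes -/

/-- An episodic MDP with episode length `H`, time-homogeneous transitions and a deterministic
reward function. -/
structure EpisodicMDP (S A : Type) (H : ℕ) where
  /-- initial state distribution -/
  init : PMF S
  /-- transition kernel, used at every step -/
  trans : S → A → PMF S
  /-- reward function -/
  reward : S → A → ℝ

/-- A stationary Markovian (randomized) policy. -/
abbrev Policy (S A : Type) := S → PMF A

/-- A deterministic policy, seen as a randomized one. -/
def detPolicy {S A : Type} (f : S → A) : Policy S A := fun s => PMF.pure (f s)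

/-- The probability of the event `Q` under the discrete law `p`. -/
def prob {α : Type} (p : PMF α) (Q : α → Prop) : ℝ≥0∞ := p.toOuterMeasure {x | Q x}

namespace EpisodicMDP

variable {S A : Type} {H : ℕ}

/-- The law of the next `n` (state, action) pairs when `π` is executed from the state `s`. -/
def rolloutFrom (M : EpisodicMDP S A H) (π : Policy S A) :
    (n : ℕ) → S → PMF (Fin n → S × A)
  | 0, _ => PMF.pure Fin.elim0
  | n + 1, s =>
      (π s).bind fun a =>
        (M.trans s a).bind fun s' =>
          (M.rolloutFrom π n s').map fun τ => (Fin.cons (s, a) τ : Fin (n + 1) → S × A)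

/-- The law of the (reward-free) trajectory `(s_h, a_h)_{h = 1, …, H}` of the policy `π`. -/
def rollout (M : EpisodicMDP S A H) (π : Policy S A) : PMF (Fin H → S × A) :=
  M.init.bind fun s => M.rolloutFrom π H s

/-- The expected return `J(π)`. -/
def J [Fintype S] [Fintype A] (M : EpisodicMDP S A H) (π : Policy S A) : ℝ :=
  ∑ τ : Fin H → S × A, (M.rollout π τ).toReal * ∑ h : Fin H, M.reward (τ h).1 (τ h).2

/-- The state visitation distribution `d^π`: the state at a uniformly random step of a rollout
of `π`. -/
def visitation [NeZero H] (M : EpisodicMDP S A H) (π : Policy S A) : PMF S :=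
  (M.rollout π).bind fun τ => (PMF.uniformOfFintype (Fin H)).map fun h => (τ h).1

end EpisodicMDP

/-! ### Imitation learning -/

section Learning

variable {S A : Type} {H : ℕ}

/-- A list of annotated states, each paired with the action the expert takes there. -/
abbrev Annotations (S A : Type) := List (S × A)

/-- The policy returned by the learning oracle from the annotations collected so far: at an
annotated state it plays the recorded expert action, at any other state a uniformly random action. -/
def learner [DecidableEq S] [Fintype A] [Nonempty A] (D : Annotations S A) : Policy S A :=
  fun s =>
    match D.lookup s with
    | some a => PMF.pure a
    | none => PMF.uniformOfFintype A

/-- Whatever annotations by the expert `πE` were collected, the learner's policy equals the expert's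
on annotated states and is uniform on all the others. -/
theorem learner_apply [DecidableEq S] [Fintype A] [Nonempty A] (πE : S → A)
    (D : Annotations S A) (hD : ∀ p ∈ D, p.2 = πE p.1) (s : S) :
    learner D s =
      if s ∈ D.map Prod.fst then detPolicy πE s else PMF.uniformOfFintype A := by
  induction D with
  | nil => simp [learner]
  | cons p D ih =>
    obtain ⟨k, a⟩ := p
    have ih' := ih fun q hq => hD q (List.mem_cons_of_mem _ hq)
    have ha : a = πE k := hD (k, a) (by simp)
    by_cases hs : s = k
    · subst hs
      simp [learner, detPolicy, ha]
    · have hb : (s == k) = false := by simpa using hs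
      have h : learner ((k, a) :: D) s = learner D s := by
        unfold learner
        rw [List.lookup_cons, hb]
      rw [h, ih']
      have hiff : s ∈ ((k, a) :: D).map Prod.fst ↔ s ∈ D.map Prod.fst := by
        rw [List.map_cons, List.mem_cons]
        exact or_iff_right hs
      simp only [hiff]

/-- `N` i.i.d. draws from `p`. -/
def iid {α : Type} (p : PMF α) : (N : ℕ) → PMF (Fin N → α)
  | 0 => PMF.pure Fin.elim0
  | N + 1 => p.bind fun x => (iid p N).map fun xs => (Fin.cons x xs : Fin (N + 1) → α)

/-- The law of the annotations contained in `N` i.i.d. offline trajectories of the expert `πE`. -/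
def offlineData (M : EpisodicMDP S A H) (πE : S → A) (N : ℕ) : PMF (Annotations S A) :=
  (iid (M.rollout (detPolicy πE)) N).map fun D =>
    (List.ofFn fun i => List.ofFn (D i)).flatten

variable [DecidableEq S] [Fintype A] [Nonempty A] [NeZero H]

/-- The law of the state of the interactive learner after `N` rounds, started from the
annotations `D₀`: all annotations held, and the list `π¹, …, πᴺ` of the policies executed. In each
round the learner executes its current policy `π`, draws one state `s ∼ d^π`, queries the expert for
`πE s`, and adds the answer to its annotations. -/
def interact (M : EpisodicMDP S A H) (πE : S → A) (D₀ : Annotations S A) :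
    ℕ → PMF (Annotations S A × List (Policy S A))
  | 0 => PMF.pure (D₀, [])
  | N + 1 =>
      (interact M πE D₀ N).bind fun x =>
        (M.visitation (learner x.1)).map fun s =>
          ((s, πE s) :: x.1, x.2 ++ [learner x.1])

/-- The policy output by Behavior Cloning from `Noff` offline expert trajectories. -/
def behaviorCloning (M : EpisodicMDP S A H) (πE : S → A) (Noff : ℕ) : PMF (Policy S A) :=
  (offlineData M πE Noff).map learner

/-- The policy that Stagger's oracle returns after `Nint` state-wise expert queries. -/
def stagger (M : EpisodicMDP S A H) (πE : S → A) (Nint : ℕ) : PMF (Policy S A) :=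
  (interact M πE [] Nint).map fun x => learner x.1

/-- The list `π¹, …, πᴺ` of the policies that Stagger executes, `N = Nint`. -/
def staggerIterates (M : EpisodicMDP S A H) (πE : S → A) (Nint : ℕ) :
    PMF (List (Policy S A)) :=
  (interact M πE [] Nint).map Prod.snd

/-- The expected return of the first-step uniform mixture of a list of policies: draw one of them
uniformly at random and execute it for the whole episode. -/
def mixtureReturn [Fintype S] (M : EpisodicMDP S A H) (P : List (Policy S A)) : ℝ :=
  (P.map M.J).sum / P.length

/-- The policy output by Warm-Stagger: `Noff` offline expert trajectories, followed by `Nint`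
interactive rounds that start from the annotations in those trajectories. -/
def warmStagger (M : EpisodicMDP S A H) (πE : S → A) (Noff Nint : ℕ) : PMF (Policy S A) :=
  (offlineData M πE Noff).bind fun D₀ => (interact M πE D₀ Nint).map fun x => learner x.1

/-- The suboptimality `J(πE) - J(π)`. -/
def subopt [Fintype S] (M : EpisodicMDP S A H) (πE : S → A) (π : Policy S A) : ℝ :=
  M.J (detPolicy πE) - M.J π

/-- Annotation cost: `1` per offline (state, action) pair, `C` per interactive query. -/
def annotationCost (H : ℕ) (C : ℝ) (Noff Nint : ℕ) : ℝ := H * Noff + C * Nint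

end Learning

/-! ### The tabular MDP -/

/-- States: `N0` ideal states `E`, `N1` recoverable states `E'`, the absorbing failure state `b`
(`dead`), and the reset state `b'` (`rest`). -/
inductive State (N0 N1 : ℕ) : Type
  | ideal (i : Fin N0)
  | recov (j : Fin N1)
  | dead
  | rest
  deriving DecidableEq, Fintype

section Construction

variable {N0 N1 : ℕ} [NeZero N0] [NeZero N1]

/-- The uniform distribution on `E`. -/
def unifIdeal : PMF (State N0 N1) := (PMF.uniformOfFintype (Fin N0)).map State.ideal

/-- The uniform distribution on `E'`. -/
def unifRecov : PMF (State N0 N1) := (PMF.uniformOfFintype (Fin N1)).map State.recov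

/-- `true` with probability `t`, `false` with probability `1 - t`. -/
def coin (t : unitInterval) : PMF Bool :=
  PMF.ofFintype
    (fun c => if c then (unitInterval.toNNReal t : ℝ≥0∞)
      else (unitInterval.toNNReal (unitInterval.symm t) : ℝ≥0∞))
    (by
      rw [Fintype.sum_bool]
      simp only [if_true, Bool.false_eq_true, if_false]
      rw [← ENNReal.coe_add, unitInterval.toNNReal_add_toNNReal_symm, ENNReal.coe_one])

/-- With probability `1 - t` a uniformly random state of `E`, with probability `t` one of `E'`. -/
def idealOrRecov (t : unitInterval) : PMF (State N0 N1) :=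
  (coin t).bind fun c => if c then unifRecov else unifIdeal

/-- `β / (1 + β)`, the initial mass of `E'`. -/
def initMass (β : unitInterval) : unitInterval :=
  ⟨(β : ℝ) / (1 + β), div_nonneg β.2.1 (by linarith [β.2.1]),
    (div_le_one (by linarith [β.2.1])).2 (by linarith)⟩

/-- The tabular MDP with parameters `N0`, `N1`, `nA` (number of actions), `H`, `β`, in which `πE s`
is the action of the expert at the state `s`. -/
def tabularMDP {nA : ℕ} (H : ℕ) (β : unitInterval) (πE : State N0 N1 → Fin nA) :
    EpisodicMDP (State N0 N1) (Fin nA) H where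
  init := idealOrRecov (initMass β)
  trans s a :=
    match s with
    | .ideal i => if a = πE (.ideal i) then idealOrRecov β else PMF.pure .dead
    | .recov j => if a = πE (.recov j) then unifIdeal else PMF.pure .rest
    | .dead => PMF.pure .dead
    | .rest => if a = πE .rest then unifIdeal else PMF.pure .rest
  reward s a :=
    match s with
    | .ideal _ => 1
    | .recov _ => 1
    | .dead => 0
    | .rest => if a = πE .rest then 1 else 0

end Construction

end

end HybridIL

namespace HybridIL

noncomputable section

/-! ### Expectations -/

/-! The expert earns `H`. A learner is governed by its unannotated states, where a uniform action
agrees with the expert only with probability `1 / nA`, at most `1 / (10 H)`. A wrong action at an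
ideal state is fatal. A wrong action at a recoverable state leads to `rest`, which is a trap exactly
as long as `rest` itself is unannotated.

Expert trajectories never contain `rest`, so Behavior Cloning must know many recoverable states:
with at most two fifths of them annotated, the return is at most `6 H / 25` (`J_le_of_few_recov`).
The expert makes at most `9` expected visits to them per trajectory, and Markov's inequality forces
many trajectories.

Stagger dies soon after meeting an unannotated ideal state. A rollout therefore makes at most `2`
such visits in expectation, a query annotates a new ideal state with probability at most `2 / H`,
and Markov's inequality applies again (`prob_idealCount_lt`). While at most five sixths of the ideal
states are known, the return is at most `12` (`J_le_of_few_ideal`). Every iterate uses a subset of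
the final annotations, so the mixture is no better.

For Warm-Stagger, a coupon-collector estimate shows that offline data cover all ideal states up to
probability `1 / 10`, which makes `dead` unreachable. Few recoverable states are known, so the
learner spends most of its episode in `rest`, and the first query hits `rest` up to probability `6 /
25`. With the ideal states and `rest` annotated no reward is ever lost (`J_eq_horizon`): even the
unannotated recoverable states only cause harmless detours.

The upper bounds on values come from potentials satisfying a Bellman inequality (`value_le`); the
rest is expectation calculus and arithmetic. -/

/-- Expectation of a nonnegative function under a discrete law. -/
def expect {α : Type} (p : PMF α) (f : α → ℝ≥0∞) : ℝ≥0∞ := ∑' x, p x * f x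

section Expect

variable {α γ : Type}

theorem expect_pure (x : α) (f : α → ℝ≥0∞) : expect (PMF.pure x) f = f x := by
  unfold expect
  rw [tsum_eq_single x]
  · simp
  · intro y hy
    simp [hy]

theorem expect_bind (p : PMF α) (q : α → PMF γ) (f : γ → ℝ≥0∞) :
    expect (p.bind q) f = expect p fun x => expect (q x) f := by
  simp only [expect, PMF.bind_apply, ← ENNReal.tsum_mul_right, ← ENNReal.tsum_mul_left, mul_assoc]
  exact ENNReal.tsum_comm

theorem expect_map (p : PMF α) (h : α → γ) (f : γ → ℝ≥0∞) :
    expect (p.map h) f = expect p fun x => f (h x) := by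
  rw [← PMF.bind_pure_comp, expect_bind]
  simp [expect_pure]

theorem expect_mono {p : PMF α} {f g : α → ℝ≥0∞} (h : ∀ x ∈ p.support, f x ≤ g x) :
    expect p f ≤ expect p g := by
  refine ENNReal.tsum_le_tsum fun x => ?_
  by_cases hx : p x = 0
  · simp [hx]
  · gcongr
    exact h x ((PMF.mem_support_iff _ _).2 hx)

theorem expect_const (p : PMF α) (c : ℝ≥0∞) : expect p (fun _ => c) = c := by
  simp [expect, ENNReal.tsum_mul_right, p.tsum_coe]

theorem expect_add (p : PMF α) (f g : α → ℝ≥0∞) :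
    expect p (fun x => f x + g x) = expect p f + expect p g := by
  simp [expect, mul_add, ENNReal.tsum_add]

open Classical in
theorem prob_eq_expect (p : PMF α) (Q : α → Prop) :
    prob p Q = expect p fun x => if Q x then 1 else 0 := by
  unfold prob expect
  rw [PMF.toOuterMeasure_apply]
  refine tsum_congr fun x => ?_
  by_cases h : Q x <;> simp [h]

theorem prob_map (p : PMF α) (h : α → γ) (Q : γ → Prop) :
    prob (p.map h) Q = prob p fun x => Q (h x) := by
  simp only [prob_eq_expect, expect_map]

theorem prob_bind (p : PMF α) (q : α → PMF γ) (Q : γ → Prop) :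
    prob (p.bind q) Q = expect p fun x => prob (q x) Q := by
  simp only [prob_eq_expect, expect_bind]

theorem prob_mono {p : PMF α} {Q R : α → Prop} (h : ∀ x ∈ p.support, Q x → R x) :
    prob p Q ≤ prob p R := by
  simp only [prob_eq_expect]
  refine expect_mono fun x hx => ?_
  by_cases hQ : Q x
  · simp [hQ, h x hx hQ]
  · simp [hQ]

theorem prob_le_one (p : PMF α) (Q : α → Prop) : prob p Q ≤ 1 := by
  rw [prob_eq_expect]
  refine (expect_mono (g := fun _ => 1) fun x _ => ?_).trans (expect_const p 1).le
  split_ifs <;> simp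

theorem prob_add_prob_not (p : PMF α) (Q : α → Prop) :
    prob p Q + prob p (fun x => ¬ Q x) = 1 := by
  rw [prob_eq_expect, prob_eq_expect, ← expect_add]
  refine Eq.trans (congrArg (expect p) (funext fun x => ?_)) (expect_const p 1)
  by_cases h : Q x <;> simp [h]

theorem half_le_prob {p : PMF α} {Q : α → Prop} (h : prob p (fun x => ¬ Q x) ≤ 1 / 2) :
    1 / 2 ≤ prob p Q := by
  by_contra! hlt
  have h1 := prob_add_prob_not p Q
  have h2 : prob p Q + prob p (fun x => ¬ Q x) < 1 / 2 + 1 / 2 :=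
    ENNReal.add_lt_add_of_lt_of_le (ne_top_of_le_ne_top (by simp) h) hlt h
  rw [h1, ENNReal.add_halves] at h2
  exact lt_irrefl _ h2

theorem ofReal_half : ENNReal.ofReal (1 / 2) = 1 / 2 := by
  rw [ENNReal.ofReal_div_of_pos (by norm_num)]
  simp

/-- Markov's inequality. -/
theorem mul_prob_le_expect (p : PMF α) (f : α → ℝ≥0∞) (t : ℝ≥0∞) :
    t * prob p (fun x => t ≤ f x) ≤ expect p f := by
  rw [prob_eq_expect, expect, ← ENNReal.tsum_mul_left]
  refine ENNReal.tsum_le_tsum fun x => ?_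
  by_cases h : t ≤ f x
  · simpa [h, mul_comm] using mul_le_mul_right h (p x)
  · simp [h]

end Expect

/-- Expectation of a real function under a law on a finite type. -/
def ev {α : Type} [Fintype α] (p : PMF α) (f : α → ℝ) : ℝ := ∑ x, (p x).toReal * f x

section Ev

variable {α γ : Type} [Fintype α] [Fintype γ]

theorem sum_toReal (p : PMF α) : ∑ x, (p x).toReal = 1 := by
  rw [← ENNReal.toReal_sum fun x _ => p.apply_ne_top x, ← tsum_fintype (L := .unconditional α),
    p.tsum_coe, ENNReal.toReal_one]

theorem ev_pure (x : α) (f : α → ℝ) : ev (PMF.pure x) f = f x := by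
  classical
  unfold ev
  rw [Finset.sum_eq_single x]
  · simp
  · intro y _ hy
    simp [hy]
  · simp

theorem ev_bind (p : PMF α) (q : α → PMF γ) (f : γ → ℝ) :
    ev (p.bind q) f = ev p fun x => ev (q x) f := by
  have h : ∀ y, (p.bind q y).toReal = ∑ x, (p x).toReal * (q x y).toReal := fun y => by
    rw [PMF.bind_apply, tsum_fintype, ENNReal.toReal_sum]
    · simp
    · exact fun x _ => ENNReal.mul_ne_top (p.apply_ne_top x) ((q x).apply_ne_top y)
  simp only [ev, h, Finset.sum_mul, Finset.mul_sum, mul_assoc]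
  exact Finset.sum_comm

theorem ev_map (p : PMF α) (h : α → γ) (f : γ → ℝ) :
    ev (p.map h) f = ev p fun x => f (h x) := by
  rw [← PMF.bind_pure_comp, ev_bind]
  simp [ev_pure]

theorem ev_mono (p : PMF α) {f g : α → ℝ} (h : ∀ x, f x ≤ g x) : ev p f ≤ ev p g :=
  Finset.sum_le_sum fun x _ => mul_le_mul_of_nonneg_left (h x) ENNReal.toReal_nonneg

theorem ev_nonneg (p : PMF α) {f : α → ℝ} (h : ∀ x, 0 ≤ f x) : 0 ≤ ev p f :=
  Finset.sum_nonneg fun x _ => mul_nonneg ENNReal.toReal_nonneg (h x)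

theorem ev_const (p : PMF α) (c : ℝ) : ev p (fun _ => c) = c := by
  rw [ev, ← Finset.sum_mul, sum_toReal, one_mul]

theorem ev_add (p : PMF α) (f g : α → ℝ) :
    ev p (fun x => f x + g x) = ev p f + ev p g := by
  simp [ev, mul_add, Finset.sum_add_distrib]

theorem ev_const_mul (p : PMF α) (c : ℝ) (f : α → ℝ) :
    ev p (fun x => c * f x) = c * ev p f := by
  simp only [ev, Finset.mul_sum]
  exact Finset.sum_congr rfl fun x _ => by ring

theorem ev_sum {ι : Type} (p : PMF α) (s : Finset ι) (f : ι → α → ℝ) :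
    ev p (fun x => ∑ i ∈ s, f i x) = ∑ i ∈ s, ev p (f i) := by
  simp only [ev, Finset.mul_sum]
  exact Finset.sum_comm

theorem ev_uniform [Nonempty α] (f : α → ℝ) :
    ev (PMF.uniformOfFintype α) f = (∑ x, f x) / Fintype.card α := by
  simp [ev, div_eq_inv_mul, Finset.mul_sum]

/-- The bridge between the two expectations: laws of annotation lists live on infinite types and
need `expect`, while trajectories form a finite type, where the real-valued `ev` permits
subtraction. -/
theorem expect_ofReal (p : PMF α) {f : α → ℝ} (hf : ∀ x, 0 ≤ f x) :
    expect p (fun x => ENNReal.ofReal (f x)) = ENNReal.ofReal (ev p f) := by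
  rw [expect, tsum_fintype, ev, ENNReal.ofReal_sum_of_nonneg]
  · refine Finset.sum_congr rfl fun x _ => ?_
    rw [ENNReal.ofReal_mul ENNReal.toReal_nonneg, ENNReal.ofReal_toReal (p.apply_ne_top x)]
  · exact fun x _ => mul_nonneg ENNReal.toReal_nonneg (hf x)

theorem ev_le_const (p : PMF α) {f : α → ℝ} {c : ℝ} (h : ∀ x, f x ≤ c) : ev p f ≤ c :=
  (ev_mono p h).trans (ev_const p c).le

/-- The mean of a function of a uniformly random point that is at most `v` off one point. -/
theorem ev_uniform_le [Nonempty α] (x₀ : α) {f : α → ℝ} {v : ℝ} (h : ∀ x, x ≠ x₀ → f x ≤ v) :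
    ev (PMF.uniformOfFintype α) f ≤ v + (f x₀ - v) / Fintype.card α := by
  classical
  have hc : (0 : ℝ) < Fintype.card α := by exact_mod_cast Fintype.card_pos
  have hs : (∑ x, f x) ≤ (f x₀ - v) + Fintype.card α * v := by
    calc (∑ x, f x) ≤ ∑ x, ((if x = x₀ then f x₀ - v else 0) + v) := by
          refine Finset.sum_le_sum fun x _ => ?_
          split_ifs with hx
          · simp [hx]
          · simpa using h x hx
      _ = (f x₀ - v) + Fintype.card α * v := by simp [Finset.sum_add_distrib]
  rw [ev_uniform, div_le_iff₀ hc, add_mul, div_mul_cancel₀ _ hc.ne']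
  linarith

end Ev

/-! ### Independent samples -/

section Iid

variable {α : Type}

theorem mem_support_of_mem_support_iid {p : PMF α} {N : ℕ} {x : Fin N → α}
    (hx : x ∈ (iid p N).support) (i : Fin N) : x i ∈ p.support := by
  induction N with
  | zero => exact i.elim0
  | succ N ih =>
    simp only [iid, PMF.mem_support_bind_iff, PMF.mem_support_map_iff] at hx
    obtain ⟨y, hy, z, hz, rfl⟩ := hx
    refine Fin.cases ?_ (fun j => ?_) i
    · simpa using hy
    · simpa using ih hz j

variable [Fintype α]

theorem ev_iid_sum (p : PMF α) (f : α → ℝ) (N : ℕ) :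
    ev (iid p N) (fun x => ∑ i, f (x i)) = N * ev p f := by
  induction N with
  | zero => simp [iid, ev_pure]
  | succ N ih =>
    simp only [iid, ev_bind, ev_map, Fin.sum_univ_succ, Fin.cons_zero, Fin.cons_succ, ev_add,
      ev_const, ih]
    push_cast
    ring

theorem ev_iid_prod (p : PMF α) (f : α → ℝ) (N : ℕ) :
    ev (iid p N) (fun x => ∏ i, f (x i)) = ev p f ^ N := by
  induction N with
  | zero => simp [iid, ev_pure]
  | succ N ih =>
    simp only [iid, ev_bind, ev_map, Fin.prod_univ_succ, Fin.cons_zero, Fin.cons_succ,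
      ev_const_mul, ih]
    rw [pow_succ', ← mul_comm (ev p f ^ N), ← ev_const_mul]
    simp only [mul_comm]

end Iid

/-! ### Values and potentials -/

namespace EpisodicMDP

variable {S A : Type} {H : ℕ} [Fintype S] [Fintype A]

/-- The expected sum of `g` over the next `n` steps. -/
def value (M : EpisodicMDP S A H) (π : Policy S A) (g : S → A → ℝ) (n : ℕ) (s : S) : ℝ :=
  ev (M.rolloutFrom π n s) fun τ => ∑ h, g (τ h).1 (τ h).2

theorem value_zero (M : EpisodicMDP S A H) (π : Policy S A) (g : S → A → ℝ) (s : S) :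
    M.value π g 0 s = 0 := by
  simp [value, rolloutFrom, ev_pure]

theorem value_succ (M : EpisodicMDP S A H) (π : Policy S A) (g : S → A → ℝ) (n : ℕ) (s : S) :
    M.value π g (n + 1) s =
      ev (π s) fun a => g s a + ev (M.trans s a) (M.value π g n) := by
  simp only [value, rolloutFrom, ev_bind, ev_map, Fin.sum_univ_succ, Fin.cons_zero, Fin.cons_succ,
    ev_add, ev_const]
  rfl

theorem ev_rollout_sum (M : EpisodicMDP S A H) (π : Policy S A) (g : S → A → ℝ) :
    ev (M.rollout π) (fun τ => ∑ h, g (τ h).1 (τ h).2) = ev M.init (M.value π g H) := by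
  rw [rollout, ev_bind]
  rfl

theorem J_eq (M : EpisodicMDP S A H) (π : Policy S A) :
    M.J π = ev M.init (M.value π M.reward H) := by
  rw [← ev_rollout_sum]
  rfl

/-- Supersolution principle: a potential that dominates its own Bellman update dominates the value,
by induction on the remaining steps. It reduces a bound on a value to exhibiting `Φ`. -/
theorem value_le (M : EpisodicMDP S A H) (π : Policy S A) (g : S → A → ℝ) (Φ : ℕ → S → ℝ)
    (h0 : ∀ s, 0 ≤ Φ 0 s)
    (h : ∀ n s, ev (π s) (fun a => g s a + ev (M.trans s a) (Φ n)) ≤ Φ (n + 1) s)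
    (n : ℕ) (s : S) : M.value π g n s ≤ Φ n s := by
  induction n generalizing s with
  | zero => simpa [value_zero] using h0 s
  | succ n ih =>
    rw [value_succ]
    refine le_trans (ev_mono _ fun a => ?_) (h n s)
    gcongr
    exact ev_mono _ ih

theorem value_mono (M : EpisodicMDP S A H) (π : Policy S A) {g g' : S → A → ℝ}
    (h : ∀ s a, g s a ≤ g' s a) (n : ℕ) (s : S) : M.value π g n s ≤ M.value π g' n s :=
  ev_mono _ fun _ => Finset.sum_le_sum fun _ _ => h _ _

theorem value_add (M : EpisodicMDP S A H) (π : Policy S A) (g g' : S → A → ℝ) (n : ℕ) (s : S) :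
    M.value π (fun s a => g s a + g' s a) n s = M.value π g n s + M.value π g' n s := by
  simp only [value, Finset.sum_add_distrib, ev_add]

/-- Averaging over a uniform step turns query probabilities into expected visit counts divided by
`H`, so that potentials control them. -/
theorem ev_visitation [NeZero H] (M : EpisodicMDP S A H) (π : Policy S A) (f : S → ℝ) :
    ev (M.visitation π) f = ev M.init (M.value π (fun s _ => f s) H) / H := by
  rw [← ev_rollout_sum, visitation, ev_bind]
  simp only [ev_map, ev_uniform, Fintype.card_fin, div_eq_inv_mul, ev_const_mul]

/-- The expected product of `g` over the next `n` steps. -/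
def prodValue (M : EpisodicMDP S A H) (π : Policy S A) (g : S → ℝ) (n : ℕ) (s : S) : ℝ :=
  ev (M.rolloutFrom π n s) fun τ => ∏ h, g (τ h).1

theorem prodValue_zero (M : EpisodicMDP S A H) (π : Policy S A) (g : S → ℝ) :
    M.prodValue π g 0 = fun _ => 1 := by
  funext s
  simp [prodValue, rolloutFrom, ev_pure]

theorem prodValue_succ (M : EpisodicMDP S A H) (π : Policy S A) (g : S → ℝ) (n : ℕ) (s : S) :
    M.prodValue π g (n + 1) s =
      g s * ev (π s) fun a => ev (M.trans s a) (M.prodValue π g n) := by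
  simp only [prodValue, rolloutFrom, ev_bind, ev_map, Fin.prod_univ_succ, Fin.cons_zero,
    Fin.cons_succ, ev_const_mul]
  rfl

theorem ev_rollout_prod (M : EpisodicMDP S A H) (π : Policy S A) (g : S → ℝ) :
    ev (M.rollout π) (fun τ => ∏ h, g (τ h).1) = ev M.init (M.prodValue π g H) := by
  rw [rollout, ev_bind]
  rfl

end EpisodicMDP

/-! ### The tabular MDP: one-step expectations -/

section Tabular

set_option linter.unusedSectionVars false

open EpisodicMDP

variable {N0 N1 nA H : ℕ} [NeZero N0] [NeZero N1]

theorem ev_coin (t : unitInterval) (f : Bool → ℝ) :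
    ev (coin t) f = t * f true + (1 - t) * f false := by
  simp [ev, coin]

theorem ev_unifIdeal (f : State N0 N1 → ℝ) :
    ev unifIdeal f = (∑ i, f (.ideal i)) / N0 := by
  rw [unifIdeal, ev_map, ev_uniform, Fintype.card_fin]

theorem ev_unifRecov (f : State N0 N1 → ℝ) :
    ev unifRecov f = (∑ j, f (.recov j)) / N1 := by
  rw [unifRecov, ev_map, ev_uniform, Fintype.card_fin]

theorem ev_idealOrRecov (t : unitInterval) (f : State N0 N1 → ℝ) :
    ev (idealOrRecov t) f = t * ev unifRecov f + (1 - t) * ev unifIdeal f := by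
  rw [idealOrRecov, ev_bind, ev_coin]
  simp

theorem ev_unifIdeal_le {f : State N0 N1 → ℝ} {c : ℝ} (h : ∀ i, f (.ideal i) ≤ c) :
    ev unifIdeal f ≤ c := by
  rw [unifIdeal, ev_map]
  exact ev_le_const _ h

theorem ev_unifRecov_le {f : State N0 N1 → ℝ} {c : ℝ} (h : ∀ j, f (.recov j) ≤ c) :
    ev unifRecov f ≤ c := by
  rw [unifRecov, ev_map]
  exact ev_le_const _ h

theorem ev_unifIdeal_const {f : State N0 N1 → ℝ} {c : ℝ} (h : ∀ i, f (.ideal i) = c) :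
    ev unifIdeal f = c := by
  rw [unifIdeal, ev_map]
  simp only [h, ev_const]

theorem ev_unifRecov_const {f : State N0 N1 → ℝ} {c : ℝ} (h : ∀ j, f (.recov j) = c) :
    ev unifRecov f = c := by
  rw [unifRecov, ev_map]
  simp only [h, ev_const]

theorem ev_idealOrRecov_le (t : unitInterval) {f : State N0 N1 → ℝ} {a b : ℝ}
    (ha : ev unifIdeal f ≤ a) (hb : ev unifRecov f ≤ b) :
    ev (idealOrRecov t) f ≤ a + t * (b - a) := by
  rw [ev_idealOrRecov]
  nlinarith [mul_le_mul_of_nonneg_left hb t.2.1,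
    mul_le_mul_of_nonneg_left ha (sub_nonneg.2 t.2.2)]

theorem ev_idealOrRecov_le_const (t : unitInterval) {f : State N0 N1 → ℝ} {c : ℝ}
    (hi : ∀ i, f (.ideal i) ≤ c) (hr : ∀ j, f (.recov j) ≤ c) :
    ev (idealOrRecov t) f ≤ c := by
  simpa using ev_idealOrRecov_le t (ev_unifIdeal_le hi) (ev_unifRecov_le hr)

/-- The mean over a finite type of a function with values `a` where `P` holds and `b` elsewhere. -/
theorem sum_ite_div (n : ℕ) [NeZero n] (P : Fin n → Prop) [DecidablePred P] (a b : ℝ) :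
    (∑ i, if P i then a else b) / n =
      b + ((Finset.univ.filter P).card / n : ℝ) * (a - b) := by
  have hn : (n : ℝ) ≠ 0 := NeZero.ne _
  have h : (∑ i, if P i then a else b) = ∑ i, (b + if P i then a - b else 0) :=
    Finset.sum_congr rfl fun i _ => by split_ifs <;> ring
  rw [h, Finset.sum_add_distrib, ← Finset.sum_filter]
  simp only [Finset.sum_const, Finset.card_univ, Fintype.card_fin, nsmul_eq_mul]
  field_simp

variable {β : unitInterval} {πE : State N0 N1 → Fin nA}

theorem trans_ideal (i : Fin N0) :
    (tabularMDP H β πE).trans (.ideal i) (πE (.ideal i)) = idealOrRecov β := by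
  simp [tabularMDP]

theorem trans_ideal_of_ne {i : Fin N0} {a : Fin nA} (h : a ≠ πE (.ideal i)) :
    (tabularMDP H β πE).trans (.ideal i) a = PMF.pure .dead := by
  simp [tabularMDP, h]

theorem trans_recov (j : Fin N1) :
    (tabularMDP H β πE).trans (.recov j) (πE (.recov j)) = unifIdeal := by
  simp [tabularMDP]

theorem trans_recov_of_ne {j : Fin N1} {a : Fin nA} (h : a ≠ πE (.recov j)) :
    (tabularMDP H β πE).trans (.recov j) a = PMF.pure .rest := by
  simp [tabularMDP, h]

theorem trans_dead (a : Fin nA) :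
    (tabularMDP H β πE).trans .dead a = PMF.pure .dead := rfl

theorem trans_rest : (tabularMDP H β πE).trans .rest (πE .rest) = unifIdeal := by
  simp [tabularMDP]

theorem trans_rest_of_ne {a : Fin nA} (h : a ≠ πE .rest) :
    (tabularMDP H β πE).trans .rest a = PMF.pure .rest := by
  simp [tabularMDP, h]

theorem reward_ideal (i : Fin N0) (a : Fin nA) :
    (tabularMDP H β πE).reward (.ideal i) a = 1 := rfl

theorem reward_recov (j : Fin N1) (a : Fin nA) :
    (tabularMDP H β πE).reward (.recov j) a = 1 := rfl

theorem reward_dead (a : Fin nA) : (tabularMDP H β πE).reward .dead a = 0 := rfl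

theorem reward_rest : (tabularMDP H β πE).reward .rest (πE .rest) = 1 := by
  simp [tabularMDP]

theorem reward_rest_of_ne {a : Fin nA} (h : a ≠ πE .rest) :
    (tabularMDP H β πE).reward .rest a = 0 := by
  simp [tabularMDP, h]

theorem init_tabular : (tabularMDP H β πE).init = idealOrRecov (initMass β) := rfl

/-- `π` agrees with the expert on `K` and is uniform elsewhere. -/
structure ExpertOn [NeZero nA] (πE : State N0 N1 → Fin nA) (K : Set (State N0 N1))
    (π : Policy (State N0 N1) (Fin nA)) : Prop where
  known : ∀ s ∈ K, π s = PMF.pure (πE s)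
  unknown : ∀ s ∉ K, π s = PMF.uniformOfFintype (Fin nA)

variable [NeZero nA]

theorem expertOn_univ : ExpertOn πE Set.univ (detPolicy πE) :=
  ⟨fun _ _ => rfl, fun s hs => absurd (Set.mem_univ s) hs⟩

variable {K : Set (State N0 N1)} {π : Policy (State N0 N1) (Fin nA)}

theorem ExpertOn.ev_known (hπ : ExpertOn πE K π) {s : State N0 N1} (hs : s ∈ K)
    (f : Fin nA → ℝ) : ev (π s) f = f (πE s) := by
  rw [hπ.known s hs, ev_pure]

/-- A uniform action guesses the expert's with chance `1 / nA`; only on that event can the bound `v`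
be exceeded. -/
theorem ExpertOn.ev_unknown_le (hπ : ExpertOn πE K π) {s : State N0 N1} (hs : s ∉ K)
    {f : Fin nA → ℝ} {v : ℝ} (h : ∀ a, a ≠ πE s → f a ≤ v) :
    ev (π s) f ≤ v + (f (πE s) - v) / nA := by
  rw [hπ.unknown s hs]
  simpa using ev_uniform_le (πE s) h

/-- Serves the states that may or may not be annotated: a bound that holds in both branches needs no
case distinction on `K`. -/
theorem ev_policy_le {s : State N0 N1} {f : Fin nA → ℝ} {v : ℝ}
    (h0 : f (πE s) ≤ v) (h : ∀ a, a ≠ πE s → f a ≤ v) : ev (π s) f ≤ v := by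
  refine ev_le_const _ fun a => ?_
  by_cases ha : a = πE s
  · rwa [ha]
  · exact h a ha

theorem le_of_unknown (hA : 500 ≤ nA) {u v c w : ℝ} (h : c ≤ v + (u - v) / nA)
    (hv : v ≤ u) (hw : v + (u - v) / 500 ≤ w) : c ≤ w := by
  have hA' : (500 : ℝ) ≤ nA := by exact_mod_cast hA
  have : (u - v) / nA ≤ (u - v) / 500 :=
    div_le_div_of_nonneg_left (sub_nonneg.2 hv) (by norm_num) hA'
  linarith

/-! ### Bounds on values -/

open Classical in
/-- The number of visits to unannotated ideal states in one rollout is at most `2` in expectation,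
since a random action there leads to `dead`. -/
theorem value_unknown_ideal_le (hA : 500 ≤ nA) (hπ : ExpertOn πE K π) (n : ℕ)
    (s : State N0 N1) :
    (tabularMDP H β πE).value π
      (fun s _ => if ∃ i, s = .ideal i ∧ s ∉ K then 1 else 0) n s ≤ 2 := by
  -- The constant `2` off `dead` works: at an unannotated ideal state one visit is counted, and the
  -- episode survives with chance `1 / nA`, so the update is at most `1 + 2 / 500`.
  let φ : State N0 N1 → ℝ := fun s => if s = .dead then 0 else 2
  have hφ : ∀ s, φ s ≤ 2 := fun s => by dsimp only [φ]; split_ifs <;> norm_num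
  have hφd : φ .dead = 0 := by simp [φ]
  refine le_trans (value_le _ _ _ (fun _ => φ) (fun s => ?_) (fun n s => ?_) n s) (hφ s)
  · dsimp only [φ]; split_ifs <;> norm_num
  · rcases s with i | j | _ | _
    · by_cases hk : State.ideal i ∈ K
      · rw [hπ.ev_known hk]
        simpa [hk, φ] using ev_le_const _ hφ
      · have hW : ev (idealOrRecov β) φ ≤ 2 := ev_le_const _ hφ
        have hW0 : 0 ≤ ev (idealOrRecov β) φ :=
          ev_nonneg _ fun s => by dsimp only [φ]; split_ifs <;> norm_num
        have h := hπ.ev_unknown_le (v := 1) hk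
          (f := fun a => (if ∃ i', State.ideal (N1 := N1) i = State.ideal i' ∧ State.ideal i ∉ K then 1 else 0)
            + ev ((tabularMDP H β πE).trans (.ideal i) a) φ)
          (fun a ha => by simp [trans_ideal_of_ne ha, ev_pure, hφd, hk])
        refine le_of_unknown hA h ?_ ?_
        · simp [trans_ideal, hk, hW0]
        · simp only [trans_ideal, hk, φ]
          simp
          linarith
    · exact ev_le_const _ fun a => by simpa [φ] using ev_le_const _ hφ
    · exact ev_le_const _ fun a => by simp [φ, trans_dead, ev_pure]
    · exact ev_le_const _ fun a => by simpa [φ] using ev_le_const _ hφ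

open Classical in
/-- If all ideal states are annotated, `dead` is not reached. -/
theorem value_dead_le (hπ : ExpertOn πE K π) (hK : ∀ i, State.ideal i ∈ K) (n : ℕ)
    {s : State N0 N1} (hs : s ≠ .dead) :
    (tabularMDP H β πE).value π (fun s _ => if s = .dead then 1 else 0) n s ≤ 0 := by
  -- All `n` remaining steps if already dead, none otherwise; the only way into `dead` is a wrong
  -- action at an ideal state.
  let Φ : ℕ → State N0 N1 → ℝ := fun n s => if s = .dead then n else 0
  have h1 : ∀ n, ev (unifIdeal (N0 := N0) (N1 := N1)) (Φ n) ≤ 0 := fun n =>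
    ev_unifIdeal_le fun i => by simp [Φ]
  have h2 : ∀ n, ev (idealOrRecov (N0 := N0) (N1 := N1) β) (Φ n) ≤ 0 := fun n =>
    ev_idealOrRecov_le_const β (fun i => by simp [Φ]) (fun i => by simp [Φ])
  refine le_trans (value_le _ _ _ Φ (fun s => ?_) (fun n s => ?_) n s) (by simp [Φ, hs])
  · simp [Φ]
  · rcases s with i | j | _ | _
    · rw [hπ.ev_known (hK i)]
      simpa [trans_ideal, Φ] using h2 n
    · refine ev_policy_le (πE := πE) ?_ fun a ha => ?_
      · simpa [trans_recov, Φ] using h1 n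
      · simp [trans_recov_of_ne ha, ev_pure, Φ]
    · exact ev_le_const _ fun a => by simp [Φ, trans_dead, ev_pure, add_comm]
    · refine ev_policy_le (πE := πE) ?_ fun a ha => ?_
      · simpa [trans_rest, Φ] using h1 n
      · simp [trans_rest_of_ne ha, ev_pure, Φ]

/-- The policy that follows the expert on the ideal states and on `rest` collects all rewards. -/
theorem J_eq_horizon (hπ : ExpertOn πE K π) (hK : ∀ i, State.ideal i ∈ K)
    (hr : State.rest ∈ K) : (tabularMDP H β πE).J π = H := by
  have key : ∀ n, ∀ s : State N0 N1, s ≠ .dead →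
      (tabularMDP H β πE).value π (tabularMDP H β πE).reward n s = n := by
    intro n
    induction n with
    | zero => simp [value_zero]
    | succ n ih =>
      have h1 : ev unifIdeal ((tabularMDP H β πE).value π (tabularMDP H β πE).reward n) = n :=
        ev_unifIdeal_const fun i => ih _ (by simp)
      have h2 : ev unifRecov ((tabularMDP H β πE).value π (tabularMDP H β πE).reward n) = n :=
        ev_unifRecov_const fun i => ih _ (by simp)
      intro s hs
      rw [value_succ]
      rcases s with i | j | _ | _
      · rw [hπ.ev_known (hK i), trans_ideal, reward_ideal, ev_idealOrRecov, h1, h2]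
        push_cast
        ring
      · rw [← ev_const (π (.recov j)) ((n + 1 : ℕ) : ℝ)]
        congr 1
        funext a
        rw [reward_recov]
        -- Either action keeps full value: `rest` is worth as much as an ideal state because the
        -- policy knows the expert's action there.
        by_cases ha : a = πE (.recov j)
        · rw [ha, trans_recov, h1]
          push_cast
          ring
        · rw [trans_recov_of_ne ha, ev_pure, ih _ (by simp)]
          push_cast
          ring
      · exact absurd rfl hs
      · rw [hπ.ev_known hr, trans_rest, reward_rest, h1]
        push_cast
        ring
  rw [J_eq, init_tabular, ev_idealOrRecov, ev_unifIdeal_const fun i => key H _ (by simp),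
    ev_unifRecov_const fun i => key H _ (by simp)]
  ring

open Classical in
/-- If at most five sixths of the ideal states are annotated, the return is at most `12`. -/
theorem J_le_of_few_ideal (hA : 500 ≤ nA) (hβ : (β : ℝ) ≤ 4 / 21) (hπ : ExpertOn πE K π)
    (hK : ((Finset.univ.filter fun i => State.ideal i ∈ K).card / N0 : ℝ) ≤ 5 / 6) :
    (tabularMDP H β πE).J π ≤ 12 := by
  -- A time-independent potential, hence a bound free of `H`. Its mean over the ideal states is at
  -- most `11 * 5/6 + 2 * 1/6 = 19/2`, which becomes at most `10` after mixing in recoverable states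
  -- with weight `β ≤ 4/21`.
  let φ : State N0 N1 → ℝ := fun s => match s with
    | .ideal i => if State.ideal i ∈ K then 11 else 2
    | .recov _ => 12
    | .dead => 0
    | .rest => 11
  have hφ : ∀ s, φ s ≤ 12 := by
    rintro (i | j | _ | _) <;> dsimp only [φ] <;> (try split_ifs) <;> norm_num
  have hφ0 : ∀ s, 0 ≤ φ s := by
    rintro (i | j | _ | _) <;> dsimp only [φ] <;> (try split_ifs) <;> norm_num
  have hI : ev unifIdeal φ ≤ 19 / 2 := by
    rw [ev_unifIdeal]
    dsimp only [φ]
    rw [sum_ite_div N0 (fun i => State.ideal i ∈ K)]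
    linarith
  have hIR : ev (idealOrRecov β) φ ≤ 10 := by
    have h := ev_idealOrRecov_le β hI (ev_unifRecov_le (c := 12) fun j => hφ (.recov j))
    linarith
  rw [J_eq]
  refine ev_le_const _ fun s => le_trans
    (value_le _ _ _ (fun _ => φ) hφ0 (fun n s => ?_) H s) (hφ s)
  rcases s with i | j | _ | _
  · by_cases hk : State.ideal i ∈ K
    · rw [hπ.ev_known hk, reward_ideal, trans_ideal]
      simp only [φ, hk, if_true] at hIR ⊢
      linarith
    · have h := hπ.ev_unknown_le (v := 1) hk
        (f := fun a => (tabularMDP H β πE).reward (.ideal i) a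
          + ev ((tabularMDP H β πE).trans (.ideal i) a) φ)
        (fun a ha => by simp [trans_ideal_of_ne ha, ev_pure, reward_ideal, φ])
      have h0 : 0 ≤ ev (idealOrRecov β) φ := ev_nonneg _ hφ0
      refine le_of_unknown hA h ?_ ?_
      · rw [trans_ideal, reward_ideal]
        linarith
      · rw [trans_ideal, reward_ideal]
        simp only [φ, hk, if_false] at hIR ⊢
        linarith
  · refine ev_policy_le (πE := πE) ?_ fun a ha => ?_
    · rw [trans_recov, reward_recov]
      exact le_trans (add_le_add_right hI 1) (by norm_num)
    · rw [trans_recov_of_ne ha, reward_recov, ev_pure]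
      norm_num [φ]
  · exact ev_le_const _ fun a => by simp [φ, trans_dead, ev_pure, reward_dead]
  · refine ev_policy_le (πE := πE) ?_ fun a ha => ?_
    · rw [trans_rest, reward_rest]
      exact le_trans (add_le_add_right hI 1) (by norm_num)
    · rw [trans_rest_of_ne ha, reward_rest_of_ne ha, ev_pure]
      norm_num [φ]

open Classical in
/-- If `rest` is not annotated and at most two fifths of the recoverable states are, then most of the
episode is spent outside the rewarding states. -/
theorem J_le_of_few_recov (hH : 50 ≤ H) (hA : 10 * H ≤ nA) (hβ : (β : ℝ) = 8 / ((H : ℝ) - 8))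
    (hπ : ExpertOn πE K π) (hr : State.rest ∉ K)
    (hK : ((Finset.univ.filter fun j => State.recov j ∈ K).card / N1 : ℝ) ≤ 2 / 5) :
    (tabularMDP H β πE).J π ≤ 6 / 25 * H := by
  have hHr : (50 : ℝ) ≤ H := by exact_mod_cast hH
  have hAr : 10 * (H : ℝ) ≤ nA := by exact_mod_cast hA
  have hA0 : (0 : ℝ) < nA := by linarith
  have hβ0 := β.2.1
  -- `X` bounds the reward before being trapped: a departure to the recoverable states takes about
  -- `1 / β ≈ H / 8` steps and traps with chance about `3/5`, giving about `5 H / 24 < X`. The drift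
  -- `3/100` per step pays for random escapes from `rest`, and `21/100 + 3/100 = 6/25`.
  set X : ℝ := 21 / 100 * H with hX
  let Φ : ℕ → State N0 N1 → ℝ := fun n s => match s with
    | .ideal _ => X + 3 / 100 * n
    | .recov j => (if State.recov j ∈ K then X + 1 else 1) + 3 / 100 * n
    | .dead => 0
    | .rest => 3 / 100 * n
  have hI : ∀ n, ev unifIdeal (Φ n) = X + 3 / 100 * n := fun n => ev_unifIdeal_const fun i => rfl
  have hR : ∀ n, ev unifRecov (Φ n) ≤ 1 + 2 / 5 * X + 3 / 100 * n := fun n => by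
    have h : ∑ j, Φ n (.recov j) =
        (∑ j : Fin N1, if State.recov j ∈ K then X + 1 else 1) + N1 * (3 / 100 * n) := by
      simp [Φ, Finset.sum_add_distrib]
    have hN : (N1 : ℝ) ≠ 0 := NeZero.ne _
    rw [ev_unifRecov, h, add_div, mul_div_cancel_left₀ _ hN,
      sum_ite_div N1 (fun j => State.recov j ∈ K)]
    nlinarith
  have hIR : ∀ (t : unitInterval) (n : ℕ),
      ev (idealOrRecov t) (Φ n) ≤ X + 3 / 100 * n - t * (3 / 5 * X - 1) := fun t n => by
    have h := ev_idealOrRecov_le t (hI n).le (hR n)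
    linarith
  -- At an annotated ideal state the reward `1` must be covered by the drift `3/100` and the
  -- expected loss of potential at departures.
  have hβX : 97 / 100 ≤ (β : ℝ) * (3 / 5 * X - 1) := by
    rw [hβ, div_mul_eq_mul_div, le_div_iff₀ (by linarith), hX]
    linarith
  have hXA : X / nA ≤ 21 / 1000 := by
    rw [div_le_iff₀ hA0]
    linarith
  have hXA1 : (X + 1) / nA ≤ 3 / 100 := by
    rw [div_le_iff₀ hA0]
    linarith
  have hΦ : ∀ n s, (tabularMDP H β πE).value π (tabularMDP H β πE).reward n s ≤ Φ n s := by
    intro n s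
    refine value_le _ _ _ Φ (fun s => ?_) (fun n s => ?_) n s
    · rcases s with i | j | _ | _ <;> dsimp only [Φ] <;> (try split_ifs) <;> norm_num <;> linarith
    have hn : (0 : ℝ) ≤ n := Nat.cast_nonneg n
    rcases s with i | j | _ | _
    · by_cases hk : State.ideal i ∈ K
      · rw [hπ.ev_known hk, reward_ideal, trans_ideal]
        dsimp only [Φ]
        push_cast
        linarith [hIR β n]
      · have h := hπ.ev_unknown_le (v := 1) hk
          (f := fun a => (tabularMDP H β πE).reward (.ideal i) a
            + ev ((tabularMDP H β πE).trans (.ideal i) a) (Φ n))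
          (fun a ha => by simp [trans_ideal_of_ne ha, ev_pure, reward_ideal, Φ])
        have hd : (1 + ev (idealOrRecov β) (Φ n) - 1) / nA ≤ 3 / 100 + 3 / 100 * n := by
          have := hIR β n
          rw [div_le_iff₀ hA0]
          nlinarith
        refine h.trans ?_
        rw [trans_ideal, reward_ideal]
        dsimp only [Φ] at hd ⊢
        push_cast
        linarith
    · by_cases hk : State.recov j ∈ K
      · rw [hπ.ev_known hk, reward_recov, trans_recov, hI]
        simp only [Φ, hk, if_true]
        push_cast
        linarith
      · have h := hπ.ev_unknown_le (v := 1 + 3 / 100 * n) hk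
          (f := fun a => (tabularMDP H β πE).reward (.recov j) a
            + ev ((tabularMDP H β πE).trans (.recov j) a) (Φ n))
          (fun a ha => by simp [trans_recov_of_ne ha, ev_pure, reward_recov, Φ])
        refine h.trans ?_
        rw [trans_recov, reward_recov, hI,
          show (1 + (X + 3 / 100 * (n : ℝ)) - (1 + 3 / 100 * n)) = X by ring]
        simp only [Φ, hk, if_false]
        push_cast
        linarith
    · exact ev_le_const _ fun a => by simp [Φ, trans_dead, ev_pure, reward_dead]
    · have h := hπ.ev_unknown_le (v := 3 / 100 * n) hr
        (f := fun a => (tabularMDP H β πE).reward .rest a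
          + ev ((tabularMDP H β πE).trans .rest a) (Φ n))
        (fun a ha => by simp [trans_rest_of_ne ha, ev_pure, reward_rest_of_ne ha, Φ])
      refine h.trans ?_
      rw [trans_rest, reward_rest, hI,
        show (1 + (X + 3 / 100 * (n : ℝ)) - 3 / 100 * n) = X + 1 by ring]
      dsimp only [Φ]
      push_cast
      linarith
  rw [J_eq, init_tabular]
  refine (ev_mono _ (hΦ H)).trans ((hIR _ H).trans ?_)
  have := mul_nonneg (initMass β).2.1 (show 0 ≤ 3 / 5 * X - 1 by linarith)
  linarith

/-! ### Expert trajectories -/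

/-- `s` is an ideal or a recoverable state. -/
def State.Good (s : State N0 N1) : Prop := s ≠ .dead ∧ s ≠ .rest

open Classical in
/-- The expert visits at most `9` recoverable states per trajectory in expectation. -/
theorem ev_rollout_recov_le (hH : 50 ≤ H) (hβ : (β : ℝ) = 8 / ((H : ℝ) - 8)) :
    ev ((tabularMDP H β πE).rollout (detPolicy πE))
      (fun τ => ∑ h, if ∃ j, (τ h).1 = State.recov j then 1 else 0) ≤ 9 := by
  have hHr : (50 : ℝ) ≤ H := by exact_mod_cast hH
  have h8 : (0 : ℝ) < H - 8 := by linarith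
  have h0 : (0 : ℝ) < H := by linarith
  -- Solves the Poisson equation of the expert's chain: the stationary mass of the recoverable
  -- states is `β / (1 + β) = 8 / H` per step, and `(H - 8) / H` is the bias of starting in one.
  let Φ : ℕ → State N0 N1 → ℝ := fun n s =>
    (if ∃ j, s = .recov j then ((H : ℝ) - 8) / H else 0) + 8 / H * n
  have hI : ∀ n, ev (unifIdeal (N0 := N0) (N1 := N1)) (Φ n) = 8 / H * n := fun n =>
    ev_unifIdeal_const fun i => by simp [Φ]
  have hR : ∀ n, ev (unifRecov (N0 := N0) (N1 := N1)) (Φ n) = (H - 8) / H + 8 / H * n := fun n =>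
    ev_unifRecov_const fun i => by simp [Φ]
  have hβ' : (β : ℝ) * ((H - 8) / H) = 8 / H := by
    rw [hβ]
    field_simp
  have hd : ((H : ℝ) - 8) / H = 1 - 8 / H := by field_simp
  have hΦ : ∀ n s, (tabularMDP H β πE).value (detPolicy πE)
      (fun s _ => if ∃ j, s = State.recov j then 1 else 0) n s ≤ Φ n s := by
    intro n s
    refine value_le _ _ _ Φ (fun s => ?_) (fun n s => ?_) n s
    · dsimp only [Φ]
      have := div_nonneg h8.le h0.le
      split_ifs <;> simp [this]
    rw [expertOn_univ.ev_known (Set.mem_univ s)]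
    have h8H : 0 ≤ 8 / (H : ℝ) := by positivity
    rcases s with i | j | _ | _
    · rw [trans_ideal, ev_idealOrRecov, hI, hR]
      simp only [Φ]
      simp
      linarith
    · rw [trans_recov, hI]
      simp only [Φ]
      simp
      linarith
    · rw [trans_dead, ev_pure]
      simp only [Φ]
      simp
      linarith
    · rw [trans_rest, hI]
      simp only [Φ]
      simp
      linarith
  have h := ev_rollout_sum (tabularMDP H β πE) (detPolicy πE)
    (fun s _ => if ∃ j, s = State.recov j then 1 else 0)
  rw [h]
  -- The bias is at most `1` from any start, and the drift over `H` steps is `8`.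
  refine ev_le_const _ fun s => (hΦ H s).trans ?_
  have h1 : ((H : ℝ) - 8) / H ≤ 1 := (div_le_one h0).2 (by linarith)
  have h2 : 8 / (H : ℝ) * H = 8 := div_mul_cancel₀ _ h0.ne'
  dsimp only [Φ]
  rw [h2]
  split_ifs <;> linarith

open Classical in
/-- The expert misses a given ideal state during the whole episode with small probability. -/
theorem ev_rollout_miss_le [NeZero H] (i : Fin N0) :
    ev ((tabularMDP H β πE).rollout (detPolicy πE))
      (fun τ => ∏ h, if (τ h).1 = State.ideal i then (0 : ℝ) else 1) ≤
      (1 - (1 - β) / N0) ^ H := by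
  set q : ℝ := 1 - (1 - β) / N0 with hq
  have hN : (1 : ℝ) ≤ N0 := by exact_mod_cast NeZero.one_le
  have hβ0 := β.2.1
  have hβ1 : (β : ℝ) ≤ 1 := β.2.2
  have hN1 : 1 / (N0 : ℝ) ≤ 1 := (div_le_one (by linarith)).2 hN
  have hN2 : 0 ≤ 1 / (N0 : ℝ) := by positivity
  have hqe : q = 1 - (1 - β) * (1 / N0) := by rw [hq]; ring
  have hq0 : 0 ≤ q := by rw [hqe]; nlinarith
  have hI : ∀ (f : State N0 N1 → ℝ) (c : ℝ),
      (∀ i', f (.ideal i') ≤ if State.ideal i' = State.ideal (N1 := N1) i then 0 else c) →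
      ev unifIdeal f ≤ (1 - 1 / N0) * c := by
    intro f c hf
    rw [ev_unifIdeal]
    have h := Finset.sum_le_sum fun i' (_ : i' ∈ Finset.univ) => hf i'
    have h2 : (∑ i', if State.ideal i' = State.ideal (N1 := N1) i then 0 else c) = (N0 - 1) * c := by
      simp only [State.ideal.injEq]
      calc (∑ i', if i' = i then 0 else c) = ∑ i', (c - if i' = i then c else 0) :=
            Finset.sum_congr rfl fun i' _ => by split_ifs <;> ring
        _ = (N0 - 1) * c := by simp [Finset.sum_sub_distrib]; ring
    rw [h2] at h
    calc _ ≤ (N0 - 1) * c / N0 := by gcongr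
      _ = _ := by field_simp
  -- The hypothesis is `t ≤ β`: one draw then hits `i` with chance at least `(1 - β) / N0`. It
  -- covers both the transitions (`t = β`) and the initial law (`t = initMass β ≤ β`).
  have hIR : ∀ (t : unitInterval) (f : State N0 N1 → ℝ) (c : ℝ), 0 ≤ c →
      (1 - (β : ℝ)) ≤ 1 - t →
      (∀ i', f (.ideal i') ≤ if State.ideal i' = State.ideal (N1 := N1) i then 0 else c) →
      (∀ j, f (.recov j) ≤ c) → ev (idealOrRecov t) f ≤ q * c := by
    intro t f c hc ht hi hr
    have h := ev_idealOrRecov_le t (hI f c hi) (ev_unifRecov_le hr)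
    refine h.trans ?_
    have : 0 ≤ ((β : ℝ) - t) * (1 / N0) * c := by
      have : 0 ≤ (β : ℝ) - t := by linarith
      positivity
    rw [hqe]
    nlinarith
  -- With the start fixed, `n + 1` visited states involve only `n` draws; the initial draw supplies
  -- the last factor `q` of `q ^ H`.
  have key : ∀ n, ∀ s : State N0 N1, s.Good →
      (tabularMDP H β πE).prodValue (detPolicy πE)
        (fun s => if s = State.ideal i then (0 : ℝ) else 1) (n + 1) s ≤
      if s = State.ideal i then 0 else q ^ n := by
    intro n
    induction n with
    | zero =>
      intro s _
      rw [prodValue_succ]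
      simp only [prodValue_zero, ev_const, mul_one, pow_zero, le_refl]
    | succ n ih =>
      intro s hs
      rw [prodValue_succ, expertOn_univ.ev_known (Set.mem_univ s)]
      have hc : 0 ≤ q ^ n := pow_nonneg hq0 n
      have hi : ∀ i' : Fin N0, _ := fun i' => ih (.ideal i') ⟨by simp, by simp⟩
      have hr : ∀ j : Fin N1, _ := fun j => ih (.recov j) ⟨by simp, by simp⟩
      split_ifs with hsi
      · simp
      · rw [one_mul, pow_succ']
        rcases s with i' | j | _ | _
        · rw [trans_ideal]
          exact hIR β _ _ hc le_rfl hi (by simpa using hr)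
        · rw [trans_recov]
          refine (hI _ _ hi).trans (mul_le_mul_of_nonneg_right ?_ hc)
          rw [hqe]
          nlinarith
        · exact absurd rfl hs.1
        · exact absurd rfl hs.2
  obtain ⟨k, hk⟩ := Nat.exists_eq_succ_of_ne_zero (NeZero.ne H)
  have h := ev_rollout_prod (tabularMDP H β πE) (detPolicy πE)
    (fun s => if s = State.ideal i then (0 : ℝ) else 1)
  rw [h, init_tabular]
  have keyH : ∀ s : State N0 N1, s.Good → _ := key k
  rw [← Nat.succ_eq_add_one, ← hk] at keyH
  conv_rhs => rw [hk, pow_succ']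
  refine hIR _ _ _ (pow_nonneg hq0 k) ?_ ?_ ?_
  · have : (initMass β : ℝ) ≤ β := by
      change (β : ℝ) / (1 + β) ≤ β
      exact div_le_self hβ0 (by linarith)
    linarith
  · exact fun i' => keyH (.ideal i') ⟨by simp, by simp⟩
  · exact fun j => by simpa using keyH (.recov j) ⟨by simp, by simp⟩

theorem good_of_mem_support_unifIdeal {s : State N0 N1} (h : s ∈ unifIdeal.support) : s.Good := by
  obtain ⟨i, -, rfl⟩ := (PMF.mem_support_map_iff _ _ _).1 h
  exact ⟨by simp, by simp⟩

theorem good_of_mem_support_idealOrRecov {t : unitInterval} {s : State N0 N1}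
    (h : s ∈ (idealOrRecov t).support) : s.Good := by
  obtain ⟨c, -, hc⟩ := (PMF.mem_support_bind_iff _ _ _).1 h
  cases c
  · exact good_of_mem_support_unifIdeal (by simpa using hc)
  · obtain ⟨j, -, rfl⟩ := (PMF.mem_support_map_iff _ _ _).1
      (show s ∈ unifRecov.support by simpa using hc)
    exact ⟨by simp, by simp⟩

theorem State.Good.trans {s s' : State N0 N1} (hs : s.Good)
    (h : s' ∈ ((tabularMDP H β πE).trans s (πE s)).support) : s'.Good := by
  rcases s with i | j | _ | _
  · rw [trans_ideal] at h
    exact good_of_mem_support_idealOrRecov h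
  · rw [trans_recov] at h
    exact good_of_mem_support_unifIdeal h
  · exact absurd rfl hs.1
  · exact absurd rfl hs.2

/-- Expert trajectories stay in the ideal and the recoverable states. -/
theorem good_of_mem_support_rolloutFrom {n : ℕ} {s : State N0 N1} (hs : s.Good)
    {τ : Fin n → State N0 N1 × Fin nA}
    (hτ : τ ∈ ((tabularMDP H β πE).rolloutFrom (detPolicy πE) n s).support) (h : Fin n) :
    (τ h).2 = πE (τ h).1 ∧ (τ h).1.Good := by
  induction n generalizing s with
  | zero => exact h.elim0
  | succ n ih =>
    simp only [rolloutFrom, detPolicy, PMF.pure_bind, PMF.mem_support_bind_iff,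
      PMF.mem_support_map_iff] at hτ
    obtain ⟨s', hs', σ, hσ, rfl⟩ := hτ
    refine Fin.cases ?_ (fun k => ?_) h
    · exact ⟨rfl, hs⟩
    · exact ih (hs.trans hs') hσ k

theorem good_of_mem_support_rollout {τ : Fin H → State N0 N1 × Fin nA}
    (hτ : τ ∈ ((tabularMDP H β πE).rollout (detPolicy πE)).support) (h : Fin H) :
    (τ h).2 = πE (τ h).1 ∧ (τ h).1.Good := by
  obtain ⟨s, hs, hτ⟩ := (PMF.mem_support_bind_iff _ _ _).1 hτ
  exact good_of_mem_support_rolloutFrom (good_of_mem_support_idealOrRecov hs) hτ h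

end Tabular

/-! ### Annotations and learners -/

section Learners

set_option linter.unusedSectionVars false

open EpisodicMDP

variable {N0 N1 nA H : ℕ} {πE : State N0 N1 → Fin nA}

/-- The annotations are answers of the expert. -/
def Valid (πE : State N0 N1 → Fin nA) (D : Annotations (State N0 N1) (Fin nA)) : Prop :=
  ∀ p ∈ D, p.2 = πE p.1

/-- The annotated states. -/
def known (D : Annotations (State N0 N1) (Fin nA)) : Set (State N0 N1) :=
  {s | s ∈ D.map Prod.fst}

theorem mem_known {D : Annotations (State N0 N1) (Fin nA)} {s : State N0 N1} :
    s ∈ known D ↔ ∃ p ∈ D, p.1 = s := by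
  simp [known]

theorem known_cons (s : State N0 N1) (a : Fin nA) (D : Annotations (State N0 N1) (Fin nA)) :
    known ((s, a) :: D) = insert s (known D) := by
  ext t
  simp [known]

theorem known_mono {D D' : Annotations (State N0 N1) (Fin nA)} (h : D ⊆ D') :
    known D ⊆ known D' := fun _ hs => by
  obtain ⟨p, hp, rfl⟩ := mem_known.1 hs
  exact mem_known.2 ⟨p, h hp, rfl⟩

theorem expertOn_learner [NeZero nA] {D : Annotations (State N0 N1) (Fin nA)}
    (hD : Valid πE D) : ExpertOn πE (known D) (learner D) where
  known s hs := by
    rw [learner_apply πE D hD, if_pos (show s ∈ D.map Prod.fst from hs)]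
    rfl
  unknown s hs := by
    rw [learner_apply πE D hD, if_neg (show s ∉ D.map Prod.fst from hs)]

open Classical in
/-- The number of annotated ideal states. -/
def idealCount (D : Annotations (State N0 N1) (Fin nA)) : ℕ :=
  (Finset.univ.filter fun i => State.ideal i ∈ known D).card

open Classical in
/-- The number of annotated recoverable states. -/
def recovCount (D : Annotations (State N0 N1) (Fin nA)) : ℕ :=
  (Finset.univ.filter fun j => State.recov j ∈ known D).card

theorem idealCount_mono {D D' : Annotations (State N0 N1) (Fin nA)} (h : D ⊆ D') :
    idealCount D ≤ idealCount D' :=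
  Finset.card_le_card fun i => by
    simp only [Finset.mem_filter, Finset.mem_univ, true_and]
    exact fun hi => known_mono h hi

open Classical in
theorem idealCount_cons_le (s : State N0 N1) (a : Fin nA)
    (D : Annotations (State N0 N1) (Fin nA)) :
    idealCount ((s, a) :: D) ≤
      idealCount D + if ∃ i, s = State.ideal i ∧ s ∉ known D then 1 else 0 := by
  by_cases hs : ∃ i, s = State.ideal i ∧ s ∉ known D
  · rw [if_pos hs]
    obtain ⟨i, rfl, hi⟩ := hs
    refine (Finset.card_le_card fun i' => ?_).trans (Finset.card_insert_le i _)
    simp [known_cons]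
  · rw [if_neg hs, add_zero]
    refine Finset.card_le_card fun i => ?_
    simp only [Finset.mem_filter, Finset.mem_univ, true_and, known_cons, Set.mem_insert_iff]
    rintro (rfl | h)
    · by_contra hi
      exact hs ⟨i, rfl, hi⟩
    · exact h

/-! ### Interaction -/

variable [NeZero N0] [NeZero N1] [NeZero nA] [NeZero H] {β : unitInterval}

/-- The last clause serves the mixture: every executed policy comes from part of the final
annotations, so it knows no more than the final policy. -/
theorem interact_invariant {M : EpisodicMDP (State N0 N1) (Fin nA) H}
    {D₀ : Annotations (State N0 N1) (Fin nA)} (hD : Valid πE D₀) {n : ℕ}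
    {x : Annotations (State N0 N1) (Fin nA) × List (Policy (State N0 N1) (Fin nA))}
    (hx : x ∈ (interact M πE D₀ n).support) :
    Valid πE x.1 ∧ D₀ ⊆ x.1 ∧ x.2.length = n ∧
      ∀ π ∈ x.2, ∃ D, Valid πE D ∧ D ⊆ x.1 ∧ π = learner D := by
  induction n generalizing x with
  | zero =>
    simp only [interact, PMF.support_pure, Set.mem_singleton_iff] at hx
    subst hx
    exact ⟨hD, List.Subset.refl _, rfl, by simp⟩
  | succ n ih =>
    simp only [interact, PMF.mem_support_bind_iff, PMF.mem_support_map_iff] at hx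
    obtain ⟨y, hy, s, -, rfl⟩ := hx
    obtain ⟨h1, h2, h3, h4⟩ := ih hy
    refine ⟨?_, List.subset_cons_of_subset _ h2, by simp [h3], ?_⟩
    · intro p hp
      rcases List.mem_cons.1 hp with rfl | hp
      · rfl
      · exact h1 p hp
    · intro π hπ
      rcases List.mem_append.1 hπ with hπ | hπ
      · obtain ⟨D, hD, hDs, rfl⟩ := h4 π hπ
        exact ⟨D, hD, List.subset_cons_of_subset _ hDs, rfl⟩
      · exact ⟨y.1, h1, List.subset_cons_self _ _, by simpa using hπ⟩

theorem prob_visitation_eq {S A : Type} [Fintype S] [Fintype A]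
    (M : EpisodicMDP S A H) (π : Policy S A) (Q : S → Prop) [DecidablePred Q] :
    prob (M.visitation π) Q =
      ENNReal.ofReal (ev M.init (M.value π (fun s _ => if Q s then 1 else 0) H) / H) := by
  rw [← ev_visitation, ← expect_ofReal _ fun s => by split_ifs <;> norm_num, prob_eq_expect]
  congr 1
  funext s
  split_ifs <;> simp

/-- Each round of interaction annotates a new ideal state with probability at most `2 / H`. -/
theorem expect_idealCount_le (hA : 500 ≤ nA) (n : ℕ) :
    expect (interact (tabularMDP H β πE) πE [] n) (fun x => (idealCount x.1 : ℝ≥0∞)) ≤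
      n * ENNReal.ofReal (2 / H) := by
  classical
  induction n with
  | zero => simp [interact, expect_pure, idealCount, known]
  | succ n ih =>
    rw [interact, expect_bind]
    have hstep : ∀ x ∈ (interact (tabularMDP H β πE) πE [] n).support,
        expect ((tabularMDP H β πE).visitation (learner x.1) |>.map fun s =>
          ((s, πE s) :: x.1, x.2 ++ [learner x.1])) (fun x => (idealCount x.1 : ℝ≥0∞)) ≤
        idealCount x.1 + ENNReal.ofReal (2 / H) := by
      intro x hx
      have hD := (interact_invariant (by simp [Valid]) hx).1
      rw [expect_map]
      have h1 : expect ((tabularMDP H β πE).visitation (learner x.1))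
          (fun s => (idealCount ((s, πE s) :: x.1) : ℝ≥0∞)) ≤
          idealCount x.1 + prob ((tabularMDP H β πE).visitation (learner x.1))
            (fun s => ∃ i, s = State.ideal i ∧ s ∉ known x.1) := by
        rw [prob_eq_expect, ← expect_const ((tabularMDP H β πE).visitation (learner x.1))
          (idealCount x.1 : ℝ≥0∞), ← expect_add]
        refine expect_mono fun s _ => ?_
        have := idealCount_cons_le s (πE s) x.1
        calc (idealCount ((s, πE s) :: x.1) : ℝ≥0∞)
            ≤ ((idealCount x.1 + if ∃ i, s = State.ideal i ∧ s ∉ known x.1 then 1 else 0 : ℕ) :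
              ℝ≥0∞) := by exact_mod_cast this
          _ = _ := by push_cast; congr!
      refine h1.trans (add_le_add_right ?_ _)
      rw [prob_visitation_eq]
      refine ENNReal.ofReal_le_ofReal (div_le_div_of_nonneg_right ?_ (Nat.cast_nonneg H))
      exact ev_le_const _ fun s => value_unknown_ideal_le hA (expertOn_learner hD) H s
    refine (expect_mono hstep).trans ?_
    rw [expect_add, expect_const]
    push_cast
    rw [add_mul, one_mul]
    exact add_le_add_left ih _

/-- After at most `H N0 / 12` rounds, more than five sixths of the ideal states are annotated with
probability less than `1 / 2`. -/
theorem prob_idealCount_lt (hA : 500 ≤ nA) {n : ℕ} (hn : (n : ℝ) ≤ H * N0 / 12) :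
    prob (interact (tabularMDP H β πE) πE [] n)
      (fun x => (5 / 6 : ℝ) < (idealCount x.1 : ℝ) / N0) < 1 / 2 := by
  have hN : (0 : ℝ) < N0 := by exact_mod_cast Nat.pos_of_ne_zero (NeZero.ne N0)
  have hH : (0 : ℝ) < H := by exact_mod_cast Nat.pos_of_ne_zero (NeZero.ne H)
  have hm := mul_prob_le_expect (interact (tabularMDP H β πE) πE [] n)
    (fun x => (idealCount x.1 : ℝ≥0∞)) (ENNReal.ofReal (5 / 6 * N0))
  have h1 : prob (interact (tabularMDP H β πE) πE [] n)
      (fun x => (5 / 6 : ℝ) < (idealCount x.1 : ℝ) / N0) ≤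
      prob (interact (tabularMDP H β πE) πE [] n)
        (fun x => ENNReal.ofReal (5 / 6 * N0) ≤ (idealCount x.1 : ℝ≥0∞)) := by
    refine prob_mono fun x _ hx => ?_
    rw [lt_div_iff₀ hN] at hx
    rw [← ENNReal.ofReal_natCast]
    exact ENNReal.ofReal_le_ofReal hx.le
  -- Markov's inequality would give `5/12 * N0 ≤ 2 * n / H`, while the budget gives `2 * n / H ≤ N0
  -- / 6`.
  by_contra! hge
  have h2 : ENNReal.ofReal (5 / 6 * N0) * (1 / 2) ≤ n * ENNReal.ofReal (2 / H) :=
    (mul_le_mul_right (hge.trans h1) _).trans (hm.trans (expect_idealCount_le hA n))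
  rw [← ofReal_half, ← ENNReal.ofReal_mul (by positivity), ← ENNReal.ofReal_natCast,
    ← ENNReal.ofReal_mul (by positivity), ENNReal.ofReal_le_ofReal_iff (by positivity)] at h2
  have h3 : (n : ℝ) * (2 / H) ≤ N0 / 6 := by
    rw [mul_div_assoc', div_le_iff₀ hH]
    linarith
  linarith

/-- If `rest` is not annotated but all ideal states are, the state queried next is `rest` with high
probability. -/
theorem prob_visitation_ne_rest_le (hH : 50 ≤ H) (hA : 10 * H ≤ nA)
    (hβ : (β : ℝ) = 8 / ((H : ℝ) - 8)) {D : Annotations (State N0 N1) (Fin nA)}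
    (hD : Valid πE D) (hr : State.rest ∉ known D) (hI : ∀ i, State.ideal i ∈ known D)
    (hR : (recovCount D / N1 : ℝ) ≤ 2 / 5) :
    prob ((tabularMDP H β πE).visitation (learner D)) (fun s => s ≠ .rest) ≤
      ENNReal.ofReal (6 / 25) := by
  classical
  have hH0 : (0 : ℝ) < H := by exact_mod_cast Nat.pos_of_ne_zero (NeZero.ne H)
  have hπ := expertOn_learner hD
  rw [prob_visitation_eq]
  refine ENNReal.ofReal_le_ofReal ((div_le_iff₀ hH0).2 ?_)
  -- Every step outside `rest` and `dead` pays `1`, so time away from `rest` is bounded by the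
  -- return plus the time in `dead`.
  have hle : ∀ s (a : Fin nA), (if s ≠ State.rest then (1 : ℝ) else 0) ≤
      (tabularMDP H β πE).reward s a + if s = State.dead then 1 else 0 := by
    rintro (i | j | _ | _) a
    · simp [reward_ideal]
    · simp [reward_recov]
    · simp [reward_dead]
    · by_cases ha : a = πE .rest
      · simp [ha, reward_rest]
      · simp [reward_rest_of_ne ha]
  calc _ ≤ ev (tabularMDP H β πE).init fun s =>
        (tabularMDP H β πE).value (learner D) (tabularMDP H β πE).reward H s +
        (tabularMDP H β πE).value (learner D) (fun s _ => if s = State.dead then 1 else 0) H s := by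
        refine ev_mono _ fun s => ?_
        rw [← value_add]
        exact value_mono _ _ hle _ _
    _ ≤ 6 / 25 * H + 0 := by
        rw [ev_add]
        refine add_le_add ?_ ?_
        · rw [← J_eq]
          exact J_le_of_few_recov hH hA hβ hπ hr hR
        · exact ev_idealOrRecov_le_const _ (fun i => value_dead_le hπ hI H (by simp))
            (fun j => value_dead_le hπ hI H (by simp))
    _ = 6 / 25 * H := add_zero _

theorem prob_interact_rest_antitone (M : EpisodicMDP (State N0 N1) (Fin nA) H)
    (D : Annotations (State N0 N1) (Fin nA)) (n : ℕ) :
    prob (interact M πE D (n + 1)) (fun x => State.rest ∉ known x.1) ≤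
      prob (interact M πE D n) (fun x => State.rest ∉ known x.1) := by
  classical
  rw [interact, prob_bind, prob_eq_expect (interact M πE D n)]
  refine expect_mono fun x _ => ?_
  by_cases hx : State.rest ∈ known x.1
  · rw [prob_map, prob_eq_expect, if_neg (not_not.2 hx)]
    refine (expect_mono (g := fun _ => 0) fun s _ => ?_).trans (expect_const _ _).le
    rw [if_neg (not_not.2 ?_)]
    rw [known_cons]
    exact Set.mem_insert_of_mem _ hx
  · rw [if_pos hx]
    exact prob_le_one _ _

/-- Annotations are never lost, so the first query alone controls failure after any positive number
of rounds. -/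
theorem prob_interact_rest_le (M : EpisodicMDP (State N0 N1) (Fin nA) H)
    (D : Annotations (State N0 N1) (Fin nA)) (n : ℕ) :
    prob (interact M πE D (n + 1)) (fun x => State.rest ∉ known x.1) ≤
      prob (M.visitation (learner D)) (fun s => s ≠ .rest) := by
  induction n with
  | zero =>
    rw [interact, interact, PMF.pure_bind, prob_map]
    refine prob_mono fun s _ hs h => hs ?_
    rw [h, known_cons]
    exact Set.mem_insert _ _
  | succ n ih => exact (prob_interact_rest_antitone M D (n + 1)).trans ih

/-! ### Offline data -/

/-- The annotations in a family of trajectories. -/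
def annotationsOf {N : ℕ} (x : Fin N → Fin H → State N0 N1 × Fin nA) :
    Annotations (State N0 N1) (Fin nA) :=
  (List.ofFn fun k => List.ofFn (x k)).flatten

theorem mem_annotationsOf {N : ℕ} {x : Fin N → Fin H → State N0 N1 × Fin nA}
    {p : State N0 N1 × Fin nA} : p ∈ annotationsOf x ↔ ∃ k h, x k h = p := by
  simp [annotationsOf, List.mem_ofFn, List.mem_flatten]

theorem mem_known_annotationsOf {N : ℕ} {x : Fin N → Fin H → State N0 N1 × Fin nA}
    {s : State N0 N1} : s ∈ known (annotationsOf x) ↔ ∃ k h, (x k h).1 = s := by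
  rw [mem_known]
  constructor
  · rintro ⟨p, hp, rfl⟩
    obtain ⟨k, h, rfl⟩ := mem_annotationsOf.1 hp
    exact ⟨k, h, rfl⟩
  · rintro ⟨k, h, rfl⟩
    exact ⟨_, mem_annotationsOf.2 ⟨k, h, rfl⟩, rfl⟩

theorem offlineData_eq (M : EpisodicMDP (State N0 N1) (Fin nA) H) (N : ℕ) :
    offlineData M πE N = (iid (M.rollout (detPolicy πE)) N).map annotationsOf := rfl

theorem offline_invariant {N : ℕ} {x : Fin N → Fin H → State N0 N1 × Fin nA}
    (hx : x ∈ (iid ((tabularMDP H β πE).rollout (detPolicy πE)) N).support) :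
    Valid πE (annotationsOf x) ∧ State.rest ∉ known (annotationsOf x) := by
  have key := fun k h => good_of_mem_support_rollout (mem_support_of_mem_support_iid hx k) h
  constructor
  · intro p hp
    obtain ⟨k, h, rfl⟩ := mem_annotationsOf.1 hp
    exact (key k h).1
  · intro hr
    obtain ⟨k, h, hkh⟩ := mem_known_annotationsOf.1 hr
    exact (key k h).2.2 hkh

open Classical in
/-- The number of visits to recoverable states in a family of trajectories. -/
def recovVisits {N : ℕ} (x : Fin N → Fin H → State N0 N1 × Fin nA) : ℝ :=
  ∑ k, ∑ h, if ∃ j, (x k h).1 = State.recov j then 1 else 0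

theorem recovVisits_nonneg {N : ℕ} (x : Fin N → Fin H → State N0 N1 × Fin nA) :
    0 ≤ recovVisits x :=
  Finset.sum_nonneg fun _ _ => Finset.sum_nonneg fun _ _ => by split_ifs <;> norm_num

/-- Distinct annotated recoverable states occupy distinct cells (trajectory, step). -/
theorem recovCount_le_recovVisits {N : ℕ} (x : Fin N → Fin H → State N0 N1 × Fin nA) :
    (recovCount (annotationsOf x) : ℝ) ≤ recovVisits x := by
  classical
  have h1 : (Finset.univ.filter fun j => State.recov j ∈ known (annotationsOf x)).map
        ⟨State.recov, fun _ _ h => State.recov.inj h⟩ ⊆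
      (Finset.univ.filter fun kh : Fin N × Fin H => ∃ j, (x kh.1 kh.2).1 = State.recov j).image
        fun kh => (x kh.1 kh.2).1 := by
    intro s hs
    simp only [Finset.mem_map, Finset.mem_filter, Finset.mem_univ, true_and,
      mem_known_annotationsOf] at hs
    obtain ⟨j, ⟨k, h, hkh⟩, rfl⟩ := hs
    exact Finset.mem_image.2 ⟨(k, h), by simp [hkh], hkh⟩
  have h2 : recovCount (annotationsOf x) ≤
      (Finset.univ.filter fun kh : Fin N × Fin H =>
        ∃ j, (x kh.1 kh.2).1 = State.recov j).card := by
    refine le_trans ?_ ((Finset.card_le_card h1).trans Finset.card_image_le)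
    rw [Finset.card_map]
    exact le_of_eq (by unfold recovCount; congr)
  refine (Nat.cast_le.2 h2).trans (le_of_eq ?_)
  rw [recovVisits, ← Fintype.sum_prod_type', ← Finset.sum_filter]
  simp

theorem ev_recovVisits_le (hH : 50 ≤ H) (hβ : (β : ℝ) = 8 / ((H : ℝ) - 8)) (N : ℕ) :
    ev (iid ((tabularMDP H β πE).rollout (detPolicy πE)) N) recovVisits ≤ 9 * N := by
  classical
  have h := ev_iid_sum ((tabularMDP H β πE).rollout (detPolicy πE))
    (fun τ => ∑ h, if ∃ j, (τ h).1 = State.recov j then (1 : ℝ) else 0) N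
  have h2 := mul_le_mul_of_nonneg_left (ev_rollout_recov_le (πE := πE) hH hβ)
    (Nat.cast_nonneg (α := ℝ) N)
  have h3 : (recovVisits : (Fin N → Fin H → State N0 N1 × Fin nA) → ℝ) =
      fun x => ∑ k, ∑ h, if ∃ j, (x k h).1 = State.recov j then (1 : ℝ) else 0 := by
    funext x
    unfold recovVisits
    congr!
  rw [h3, h]
  refine (le_of_eq ?_).trans (h2.trans (by linarith))
  congr!

open Classical in
/-- The number of ideal states that a family of trajectories misses. -/
def idealMisses {N : ℕ} (x : Fin N → Fin H → State N0 N1 × Fin nA) : ℝ :=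
  ∑ i : Fin N0, ∏ k, ∏ h, if (x k h).1 = State.ideal i then 0 else 1

theorem idealMisses_nonneg {N : ℕ} (x : Fin N → Fin H → State N0 N1 × Fin nA) :
    0 ≤ idealMisses x :=
  Finset.sum_nonneg fun _ _ => Finset.prod_nonneg fun _ _ =>
    Finset.prod_nonneg fun _ _ => by split_ifs <;> norm_num

theorem one_le_idealMisses {N : ℕ} {x : Fin N → Fin H → State N0 N1 × Fin nA} {i : Fin N0}
    (hi : State.ideal i ∉ known (annotationsOf x)) : 1 ≤ idealMisses x := by
  classical
  rw [mem_known_annotationsOf] at hi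
  push Not at hi
  have h1 : (∏ k, ∏ h, if (x k h).1 = State.ideal i then (0 : ℝ) else 1) = 1 :=
    Finset.prod_eq_one fun k _ => Finset.prod_eq_one fun h _ => if_neg (hi k h)
  unfold idealMisses
  refine le_trans (by convert h1.ge) (Finset.single_le_sum (f := fun i : Fin N0 =>
    ∏ k, ∏ h, if (x k h).1 = State.ideal i then (0 : ℝ) else 1) (fun _ _ =>
      Finset.prod_nonneg fun _ _ => Finset.prod_nonneg fun _ _ => by split_ifs <;> norm_num)
    (Finset.mem_univ i))

/-- Linearity over ideal states and independence over trajectories; with `one_le_idealMisses` this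
acts as a union bound. -/
theorem ev_idealMisses_le (N : ℕ) :
    ev (iid ((tabularMDP H β πE).rollout (detPolicy πE)) N) idealMisses ≤
      N0 * ((1 - (1 - β) / N0) ^ H) ^ N := by
  classical
  unfold idealMisses
  rw [ev_sum]
  calc _ ≤ ∑ _i : Fin N0, (((1 - (1 - (β : ℝ)) / N0) ^ H) ^ N) := by
        refine Finset.sum_le_sum fun i _ => ?_
        have h := ev_iid_prod ((tabularMDP H β πE).rollout (detPolicy πE))
          (fun τ => ∏ h, if (τ h).1 = State.ideal i then (0 : ℝ) else 1) N
        have h2 := ev_rollout_miss_le (H := H) (β := β) (πE := πE) i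
        have h0 : 0 ≤ ev ((tabularMDP H β πE).rollout (detPolicy πE))
            (fun τ => ∏ h, if (τ h).1 = State.ideal i then (0 : ℝ) else 1) :=
          ev_nonneg _ fun _ => Finset.prod_nonneg fun _ _ => by split_ifs <;> norm_num
        refine (le_of_eq ?_).trans (h.le.trans (pow_le_pow_left₀ h0 (le_trans (le_of_eq ?_) h2) N))
        · congr!
        · congr!
    _ = _ := by simp

end Learners

/-! ### Guarantees of the three learners -/

section Guarantees

set_option linter.unusedSectionVars false

open EpisodicMDP

variable {N0 N1 nA H : ℕ} [NeZero N0] [NeZero N1] [NeZero nA] [NeZero H]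
  {πE : State N0 N1 → Fin nA} {β : unitInterval}

theorem J_expert : (tabularMDP H β πE).J (detPolicy πE) = H :=
  J_eq_horizon expertOn_univ (fun _ => Set.mem_univ _) (Set.mem_univ _)

theorem beta_le (hH : 50 ≤ H) (hβ : (β : ℝ) = 8 / ((H : ℝ) - 8)) : (β : ℝ) ≤ 4 / 21 := by
  have hHr : (50 : ℝ) ≤ H := by exact_mod_cast hH
  rw [hβ, div_le_iff₀ (by linarith)]
  linarith

theorem behaviorCloning_lower_bound (hH : 50 ≤ H) (hA : 10 * H ≤ nA)
    (hβ : (β : ℝ) = 8 / ((H : ℝ) - 8)) {N : ℕ}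
    (h : 1 / 2 ≤ prob (behaviorCloning (tabularMDP H β πE) πE N)
      (fun π => subopt (tabularMDP H β πE) πE π < (H : ℝ) / 2)) :
    (N1 : ℝ) / 160 ≤ N := by
  have hN : (0 : ℝ) < N1 := by exact_mod_cast Nat.pos_of_ne_zero (NeZero.ne N1)
  have hHr : (50 : ℝ) ≤ H := by exact_mod_cast hH
  rw [behaviorCloning, offlineData_eq, prob_map, prob_map] at h
  set p := iid ((tabularMDP H β πE).rollout (detPolicy πE)) N
  -- Success needs a return above `H / 2 > 6 H / 25`; as `rest` is unannotated, more than two fifths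
  -- of the recoverable states must be known.
  have h1 := h.trans (prob_mono (R := fun x =>
      ENNReal.ofReal (2 / 5 * N1) ≤ ENNReal.ofReal (recovVisits x)) fun x hx hQ => by
    obtain ⟨hV, hr⟩ := offline_invariant hx
    refine ENNReal.ofReal_le_ofReal (le_trans ?_ (recovCount_le_recovVisits x))
    by_contra! hlt
    have hJ := J_le_of_few_recov hH hA hβ (expertOn_learner hV) hr
      ((div_le_iff₀ hN).2 (by simpa [recovCount] using hlt.le))
    rw [subopt, J_expert] at hQ
    linarith)
  have h2 : ENNReal.ofReal (2 / 5 * N1) * (1 / 2) ≤ ENNReal.ofReal (9 * N) :=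
    calc _ ≤ _ := mul_le_mul_right h1 _
      _ ≤ _ := mul_prob_le_expect p _ _
      _ = _ := expect_ofReal p recovVisits_nonneg
      _ ≤ _ := ENNReal.ofReal_le_ofReal (ev_recovVisits_le hH hβ N)
  rw [← ofReal_half, ← ENNReal.ofReal_mul (by positivity),
    ENNReal.ofReal_le_ofReal_iff (by positivity)] at h2
  linarith

/-- Whatever is true of the interaction only when many ideal states are annotated needs many rounds
to become likely. -/
theorem interact_lower_bound (hA : 500 ≤ nA) {n : ℕ}
    {Q : Annotations (State N0 N1) (Fin nA) × List (Policy (State N0 N1) (Fin nA)) → Prop}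
    (hQ : ∀ x ∈ (interact (tabularMDP H β πE) πE [] n).support,
      (idealCount x.1 : ℝ) / N0 ≤ 5 / 6 → ¬ Q x)
    (h : 1 / 2 ≤ prob (interact (tabularMDP H β πE) πE [] n) Q) : (H : ℝ) * N0 / 12 < n := by
  by_contra! hn
  refine absurd (prob_idealCount_lt (β := β) (πE := πE) hA hn) (not_lt.2 (h.trans ?_))
  exact prob_mono fun x hx hQx => not_le.1 fun hle => hQ x hx hle hQx

theorem J_learner_le (hH : 50 ≤ H) (hA : 10 * H ≤ nA) (hβ : (β : ℝ) = 8 / ((H : ℝ) - 8))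
    {D : Annotations (State N0 N1) (Fin nA)} (hD : Valid πE D)
    (hI : (idealCount D : ℝ) / N0 ≤ 5 / 6) :
    (tabularMDP H β πE).J (learner D) ≤ H / 2 := by
  have hHr : (50 : ℝ) ≤ H := by exact_mod_cast hH
  have := J_le_of_few_ideal (H := H) (by omega) (beta_le hH hβ) (expertOn_learner hD) hI
  linarith

theorem stagger_lower_bound (hH : 50 ≤ H) (hA : 10 * H ≤ nA)
    (hβ : (β : ℝ) = 8 / ((H : ℝ) - 8)) {n : ℕ}
    (h : 1 / 2 ≤ prob (stagger (tabularMDP H β πE) πE n)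
      (fun π => subopt (tabularMDP H β πE) πE π < (H : ℝ) / 2)) :
    (H : ℝ) * N0 / 12 < n := by
  rw [stagger, prob_map] at h
  refine interact_lower_bound (by omega) (fun x hx hI hQ => ?_) h
  have hJ := J_learner_le hH hA hβ (interact_invariant (by simp [Valid]) hx).1 hI
  rw [subopt, J_expert] at hQ
  linarith

theorem sum_map_le {α : Type} (f : α → ℝ) (c : ℝ) (l : List α) (h : ∀ x ∈ l, f x ≤ c) :
    (l.map f).sum ≤ l.length * c := by
  simpa using List.sum_le_card_nsmul (l.map f) c (by simpa using h)

theorem staggerIterates_lower_bound (hH : 50 ≤ H) (hA : 10 * H ≤ nA)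
    (hβ : (β : ℝ) = 8 / ((H : ℝ) - 8)) {n : ℕ}
    (h : 1 / 2 ≤ prob (staggerIterates (tabularMDP H β πE) πE n)
      (fun P => (tabularMDP H β πE).J (detPolicy πE) - mixtureReturn (tabularMDP H β πE) P <
        (H : ℝ) / 2)) :
    (H : ℝ) * N0 / 12 < n := by
  have hN : (0 : ℝ) < N0 := by exact_mod_cast Nat.pos_of_ne_zero (NeZero.ne N0)
  rw [staggerIterates, prob_map] at h
  refine interact_lower_bound (by omega) (fun x hx hI hQ => ?_) h
  obtain ⟨-, -, -, h4⟩ := interact_invariant (by simp [Valid]) hx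
  have hJ : ∀ π ∈ x.2, (tabularMDP H β πE).J π ≤ H / 2 := fun π hπ => by
    obtain ⟨D, hD, hDs, rfl⟩ := h4 π hπ
    refine J_learner_le hH hA hβ hD (le_trans ?_ hI)
    gcongr
    exact_mod_cast idealCount_mono hDs
  have hm : mixtureReturn (tabularMDP H β πE) x.2 ≤ H / 2 := by
    -- This covers zero rounds as well: the mixture return of the empty list is `0 / 0 = 0`.
    refine div_le_of_le_mul₀ (Nat.cast_nonneg _) (by positivity) ?_
    rw [mul_comm]
    exact sum_map_le _ _ _ hJ
  rw [J_expert] at hQ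
  linarith

/-- The number of offline trajectories, bounded linearly in `N0`. -/
theorem offline_budget_le (hH : 50 ≤ H) (hHN0 : 5 / 4 * Real.log (10 * N0) ≤ H)
    (hβ : (β : ℝ) = 8 / ((H : ℝ) - 8)) :
    (N0 : ℝ) / ((1 - β) * H) * Real.log (10 * N0) ≤ 84 / 85 * N0 := by
  have hHr : (50 : ℝ) ≤ H := by exact_mod_cast hH
  have hb := beta_le hH hβ
  have hN : (0 : ℝ) ≤ N0 := Nat.cast_nonneg _
  have hpos : 0 < (1 - (β : ℝ)) * H := mul_pos (by linarith) (by linarith)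
  rw [div_mul_eq_mul_div, div_le_iff₀ hpos]
  -- `84/85 = (4/5) / (17/21)`, from `log (10 N0) ≤ 4 H / 5` and `1 - β ≥ 17/21`.
  have h1 : Real.log (10 * N0) ≤ 84 / 85 * ((1 - (β : ℝ)) * H) := by nlinarith
  calc _ ≤ (N0 : ℝ) * (84 / 85 * ((1 - (β : ℝ)) * H)) := by gcongr
    _ = _ := by ring

theorem offline_ceil_le (hH : 50 ≤ H) (hHN0 : 5 / 4 * Real.log (10 * N0) ≤ H)
    (hβ : (β : ℝ) = 8 / ((H : ℝ) - 8)) :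
    (⌈(N0 : ℝ) / ((1 - β) * H) * Real.log (10 * N0)⌉₊ : ℝ) ≤
      6 * (N0 / H * Real.log N0) + 1 := by
  have hHr : (50 : ℝ) ≤ H := by exact_mod_cast hH
  have hb := beta_le hH hβ
  have hle := offline_budget_le hH hHN0 hβ
  rcases Nat.lt_or_ge N0 2 with h1 | h2
  · have hN : N0 = 1 := by
      have := Nat.pos_of_ne_zero (NeZero.ne N0)
      omega
    subst hN
    -- Here `log N0 = 0`, so the ceiling itself must be at most `1`; this is why the budget bound
    -- needs a factor below `1`.
    have : ⌈((1 : ℕ) : ℝ) / ((1 - β) * H) * Real.log (10 * (1 : ℕ))⌉₊ ≤ 1 := by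
      rw [Nat.ceil_le]
      refine hle.trans ?_
      norm_num
    simp only [Nat.cast_one, Real.log_one, mul_zero, zero_add] at this ⊢
    exact_mod_cast this
  · have hN : (2 : ℝ) ≤ N0 := by exact_mod_cast h2
    -- For `N0 ≥ 2` this yields `log (10 N0) ≤ 9/2 * log N0`, and `9/2 < 6 * 17/21`.
    have hl2 : 2 * Real.log 10 ≤ 7 * Real.log 2 := by
      have h := Real.log_le_log (by norm_num) (show (10 : ℝ) ^ 2 ≤ 2 ^ 7 by norm_num)
      rw [Real.log_pow, Real.log_pow] at h
      exact_mod_cast h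
    have hlN := Real.log_le_log (by norm_num) hN
    have hlog : Real.log (10 * N0) = Real.log 10 + Real.log N0 :=
      Real.log_mul (by norm_num) (by linarith)
    have hl0 : 0 < Real.log 2 := Real.log_pos (by norm_num)
    have hx0 : 0 ≤ (N0 : ℝ) / ((1 - β) * H) * Real.log (10 * N0) := by
      have h1β : 0 ≤ 1 - (β : ℝ) := by linarith
      have : 0 ≤ Real.log (10 * N0) := Real.log_nonneg (by linarith)
      positivity
    refine (Nat.ceil_lt_add_one hx0).le.trans (add_le_add_left ?_ 1)
    have hpos : 0 < (1 - (β : ℝ)) * H := mul_pos (by linarith) (by linarith)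
    have hmain : Real.log (10 * N0) ≤ 6 * (1 - (β : ℝ)) * Real.log N0 := by
      have : 6 * (17 / 21) * Real.log N0 ≤ 6 * (1 - (β : ℝ)) * Real.log N0 := by
        gcongr
        linarith
      linarith
    rw [div_mul_eq_mul_div, div_le_iff₀ hpos]
    calc (N0 : ℝ) * Real.log (10 * N0) ≤ N0 * (6 * (1 - (β : ℝ)) * Real.log N0) := by gcongr
      _ = _ := by field_simp

/-- Coupon collecting: `(1 - x) ^ m ≤ exp (-m x)` with `x = (1 - β) / N0` and `m = H N`; the `10` in
the logarithm becomes the failure probability. -/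
theorem miss_probability_le {N : ℕ} (hH : 50 ≤ H) (hβ : (β : ℝ) = 8 / ((H : ℝ) - 8))
    (hN : (N0 : ℝ) / ((1 - β) * H) * Real.log (10 * N0) ≤ N) :
    N0 * ((1 - (1 - (β : ℝ)) / N0) ^ H) ^ N ≤ 1 / 10 := by
  have hHr : (50 : ℝ) ≤ H := by exact_mod_cast hH
  have hN0 : (1 : ℝ) ≤ N0 := by exact_mod_cast NeZero.one_le
  have hb := beta_le hH hβ
  have hβ0 := β.2.1
  have hpos : 0 < (1 - (β : ℝ)) * H := mul_pos (by linarith) (by linarith)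
  have hq0 : 0 ≤ 1 - (1 - (β : ℝ)) / N0 := by
    rw [sub_nonneg, div_le_one (by linarith)]
    linarith
  have hq : 1 - (1 - (β : ℝ)) / N0 ≤ Real.exp (-((1 - β) / N0)) := Real.one_sub_le_exp_neg _
  have hlog : Real.log (10 * N0) ≤ (H * N : ℕ) * ((1 - (β : ℝ)) / N0) := by
    rw [div_mul_eq_mul_div, div_le_iff₀ hpos] at hN
    rw [mul_div_assoc', le_div_iff₀ (by linarith)]
    push_cast
    linarith
  have hexp : ((1 - (1 - (β : ℝ)) / N0) ^ H) ^ N ≤ 1 / (10 * N0) := by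
    rw [← pow_mul]
    calc _ ≤ Real.exp (-((1 - β) / N0)) ^ (H * N) := pow_le_pow_left₀ hq0 hq _
      _ = Real.exp (-((H * N : ℕ) * ((1 - (β : ℝ)) / N0))) := by
        rw [← Real.exp_nat_mul]
        ring_nf
      _ ≤ Real.exp (-Real.log (10 * N0)) := Real.exp_le_exp.2 (neg_le_neg hlog)
      _ = 1 / (10 * N0) := by
        rw [Real.exp_neg, Real.exp_log (by linarith), one_div]
  calc _ ≤ (N0 : ℝ) * (1 / (10 * N0)) := by gcongr
    _ = 1 / 10 := by field_simp

/-- The failure probability of the interactive phase, given the offline trajectories. -/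
theorem prob_interact_fail_le (hH : 50 ≤ H) (hA : 10 * H ≤ nA)
    (hβ : (β : ℝ) = 8 / ((H : ℝ) - 8)) {N : ℕ} (n : ℕ)
    {x : Fin N → Fin H → State N0 N1 × Fin nA}
    (hx : x ∈ (iid ((tabularMDP H β πE).rollout (detPolicy πE)) N).support) :
    prob (interact (tabularMDP H β πE) πE (annotationsOf x) (n + 1))
      (fun y => ¬ (tabularMDP H β πE).J (learner y.1) =
        (tabularMDP H β πE).J (detPolicy πE)) ≤
      ENNReal.ofReal (idealMisses x + (6 / 25 + 19 / 10 / N1 * recovVisits x)) := by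
  have hN : (0 : ℝ) < N1 := by exact_mod_cast Nat.pos_of_ne_zero (NeZero.ne N1)
  obtain ⟨hV, hr⟩ := offline_invariant hx
  have hm0 := idealMisses_nonneg x
  have hv0 := recovVisits_nonneg x
  have hw0 : 0 ≤ 19 / 10 / N1 * recovVisits x := by positivity
  -- On bad offline data the right side is already at least `1`, so the bound is trivial there.
  have hone : 1 ≤ idealMisses x + (6 / 25 + 19 / 10 / N1 * recovVisits x) →
      prob (interact (tabularMDP H β πE) πE (annotationsOf x) (n + 1))
        (fun y => ¬ (tabularMDP H β πE).J (learner y.1) =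
          (tabularMDP H β πE).J (detPolicy πE)) ≤
      ENNReal.ofReal (idealMisses x + (6 / 25 + 19 / 10 / N1 * recovVisits x)) := fun h =>
    (prob_le_one _ _).trans (by simpa using ENNReal.ofReal_le_ofReal h)
  by_cases hI : ∀ i, State.ideal i ∈ known (annotationsOf x)
  · by_cases hR : (recovCount (annotationsOf x) / N1 : ℝ) ≤ 2 / 5
    · calc _ ≤ prob (interact (tabularMDP H β πE) πE (annotationsOf x) (n + 1))
            (fun y => State.rest ∉ known y.1) := by
            refine prob_mono fun y hy hJ hrest => hJ ?_
            obtain ⟨h1, h2, -, -⟩ := interact_invariant hV hy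
            rw [J_expert]
            exact J_eq_horizon (expertOn_learner h1) (fun i => known_mono h2 (hI i)) hrest
        _ ≤ _ := prob_interact_rest_le _ _ n
        _ ≤ _ := prob_visitation_ne_rest_le hH hA hβ hV hr hI hR
        _ ≤ _ := ENNReal.ofReal_le_ofReal (by linarith)
    · refine hone ?_
      rw [not_le, lt_div_iff₀ hN] at hR
      have h1 := hR.le.trans (recovCount_le_recovVisits x)
      -- The weight `19/10` is chosen so that `19/10 * 2/5 = 1 - 6/25`.
      have h2 : 19 / 25 ≤ 19 / 10 / N1 * recovVisits x := by
        rw [div_mul_eq_mul_div, le_div_iff₀ hN]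
        linarith
      linarith
  · obtain ⟨i, hi⟩ := not_forall.1 hI
    exact hone (by linarith [one_le_idealMisses hi])

theorem warmStagger_upper_bound (hH : 50 ≤ H) (hHN0 : 5 / 4 * Real.log (10 * N0) ≤ H)
    (hA : 10 * H ≤ nA) (hN1 : 500 ≤ N1) (hN1N0 : 160 * N0 ≤ N1)
    (hβ : (β : ℝ) = 8 / ((H : ℝ) - 8)) {N : ℕ}
    (hN : N = ⌈(N0 : ℝ) / ((1 - β) * H) * Real.log (10 * N0)⌉₊) (n : ℕ) :
    1 / 2 ≤ prob (warmStagger (tabularMDP H β πE) πE N (n + 1))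
      (fun π => (tabularMDP H β πE).J π = (tabularMDP H β πE).J (detPolicy πE)) := by
  have hN1r : (500 : ℝ) ≤ N1 := by exact_mod_cast hN1
  have hN1N0r : 160 * (N0 : ℝ) ≤ N1 := by exact_mod_cast hN1N0
  have hb := beta_le hH hβ
  have hge : (N0 : ℝ) / ((1 - β) * H) * Real.log (10 * N0) ≤ N := hN ▸ Nat.le_ceil _
  have hx0 : 0 ≤ (N0 : ℝ) / ((1 - β) * H) * Real.log (10 * N0) := by
    have hN0 : (1 : ℝ) ≤ N0 := by exact_mod_cast NeZero.one_le
    have h1β : 0 ≤ 1 - (β : ℝ) := by linarith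
    have : 0 ≤ Real.log (10 * N0) := Real.log_nonneg (by linarith)
    positivity
  have hle : (N : ℝ) ≤ 84 / 85 * N0 + 1 := by
    rw [hN]
    exact (Nat.ceil_lt_add_one hx0).le.trans
      (add_le_add_left (offline_budget_le hH hHN0 hβ) 1)
  refine half_le_prob ?_
  rw [warmStagger, offlineData_eq, prob_bind, expect_map]
  simp only [prob_map]
  refine (expect_mono fun x hx => prob_interact_fail_le hH hA hβ n hx).trans ?_
  rw [expect_ofReal _ fun x => ?_, ← ofReal_half]
  · refine ENNReal.ofReal_le_ofReal ?_
    rw [ev_add, ev_add, ev_const, ev_const_mul]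
    have h1 := (ev_idealMisses_le (H := H) (πE := πE) (β := β) N).trans
      (miss_probability_le hH hβ hge)
    have h2 : 19 / 10 / N1 * ev (iid ((tabularMDP H β πE).rollout (detPolicy πE)) N) recovVisits ≤
        4 / 25 := by
      calc _ ≤ 19 / 10 / N1 * (9 * (N : ℝ)) := by
            gcongr
            exact ev_recovVisits_le hH hβ N
        -- Uses `N ≤ 84/85 * N0 + 1` together with `N0 ≤ N1 / 160` and `1 ≤ N1 / 500`.
        _ ≤ 4 / 25 := by
            rw [div_mul_eq_mul_div, div_le_iff₀ (by linarith)]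
            linarith
    -- The budget is exactly spent: `1/10 + 6/25 + 4/25 = 1/2`.
    linarith
  · have := idealMisses_nonneg x
    have := recovVisits_nonneg x
    positivity

end Guarantees

end
end HybridIL

/-! ### Assembly of the guarantees and their costs -/

theorem mainTheorem3
    (N0 N1 nA H : ℕ) [NeZero N0] [NeZero N1] [NeZero nA] [NeZero H]
    (hH : 50 ≤ H) (hHN0 : 5 / 4 * Real.log (10 * N0) ≤ H) (hA : 10 * H ≤ nA)
    (hN1 : 500 ≤ N1) (hN1N0 : 160 * N0 ≤ N1)
    (β : unitInterval) (hβ : (β : ℝ) = 8 / ((H : ℝ) - 8))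
    (πE : HybridIL.State N0 N1 → Fin nA)
    (M : HybridIL.EpisodicMDP (HybridIL.State N0 N1) (Fin nA) H)
    (hM : M = HybridIL.tabularMDP H β πE)
    (C : ℝ) (hC : 1 ≤ C) :
    -- Behavior Cloning
    (∀ Noff : ℕ,
      1 / 2 ≤ HybridIL.prob (HybridIL.behaviorCloning M πE Noff)
        (fun π => HybridIL.subopt M πE π < (H : ℝ) / 2) →
      (N1 : ℝ) / 160 ≤ Noff ∧
        (H : ℝ) * N1 / 160 ≤ HybridIL.annotationCost H C Noff 0) ∧
    -- Stagger, outputting the policy that follows all annotations collected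
    (∀ Nint : ℕ,
      1 / 2 ≤ HybridIL.prob (HybridIL.stagger M πE Nint)
        (fun π => HybridIL.subopt M πE π < (H : ℝ) / 2) →
      (H : ℝ) * N0 / 12 < Nint ∧
        C * (H * N0) / 12 < HybridIL.annotationCost H C 0 Nint) ∧
    -- Stagger, outputting the first-step uniform mixture of the policies executed
    (∀ Nint : ℕ,
      1 / 2 ≤ HybridIL.prob (HybridIL.staggerIterates M πE Nint)
        (fun P => M.J (HybridIL.detPolicy πE) - HybridIL.mixtureReturn M P < (H : ℝ) / 2) →
      (H : ℝ) * N0 / 12 < Nint ∧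
        C * (H * N0) / 12 < HybridIL.annotationCost H C 0 Nint) ∧
    -- Warm-Stagger
    (∃ Noff : ℕ,
      Noff = ⌈(N0 : ℝ) / ((1 - β) * H) * Real.log (10 * N0)⌉₊ ∧
      (Noff : ℝ) ≤ 6 * (N0 / H * Real.log N0) + 1 ∧
      HybridIL.annotationCost H C Noff 3 ≤ 6 * (N0 * Real.log N0) + H + 3 * C ∧
      1 / 2 ≤ HybridIL.prob (HybridIL.warmStagger M πE Noff 3)
        (fun π => M.J π = M.J (HybridIL.detPolicy πE))) := by
  subst hM
  have hN : (0 : ℝ) < H := by exact_mod_cast Nat.pos_of_ne_zero (NeZero.ne H)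
  have hcost : ∀ n : ℕ, (H : ℝ) * N0 / 12 < n →
      (H : ℝ) * N0 / 12 < n ∧ C * (H * N0) / 12 < HybridIL.annotationCost H C 0 n := by
    intro n hn
    refine ⟨hn, ?_⟩
    have := mul_lt_mul_of_pos_left hn (show 0 < C by linarith)
    simp only [HybridIL.annotationCost, Nat.cast_zero, mul_zero, zero_add]
    linarith
  refine ⟨fun N h => ?_, fun n h => ?_, fun n h => ?_, _, rfl, ?_, ?_, ?_⟩
  · have h1 := HybridIL.behaviorCloning_lower_bound hH hA hβ h
    refine ⟨h1, ?_⟩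
    have := mul_le_mul_of_nonneg_left h1 hN.le
    simp only [HybridIL.annotationCost, Nat.cast_zero, mul_zero, add_zero]
    linarith
  · exact hcost n (HybridIL.stagger_lower_bound hH hA hβ h)
  · exact hcost n (HybridIL.staggerIterates_lower_bound hH hA hβ h)
  · exact HybridIL.offline_ceil_le hH hHN0 hβ
  · have h1 := mul_le_mul_of_nonneg_left (HybridIL.offline_ceil_le hH hHN0 hβ) hN.le
    have h2 : (H : ℝ) * (6 * (N0 / H * Real.log N0) + 1) = 6 * (N0 * Real.log N0) + H := by
      field_simp
    simp only [HybridIL.annotationCost]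
    push_cast
    linarith
  · exact HybridIL.warmStagger_upper_bound hH hHN0 hA hN1 hN1N0 hβ rfl 2
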